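/- Let $n\ge 0$ be an integer, let $\Omega\subset\mathbb R^n$ be an open convex set, let $u:\Omega\to\mathbb R$ be convex, and let $\lambda,\Lambda$ be positive constants. For a convex function $w$ on an open convex set $W\subset\mathbb R^n$ and $x_0\in W$ let $$\partial w(x_0)=\{p\in\mathbb R^n:\ w(x)\ge w(x_0)+p\cdot(x-x_0)\ \text{for all }x\in W\},$$ and for a Borel set $E\subset W$ let $\mathcal M w(E)=\bigl|\bigcup_{x\in E}\partial w(x)\bigr|$ be its Monge–Ampère measure, where $|\cdot|$ is Lebesgue measure. Suppose that $\lambda\le\det D^2u\le\Lambda$ on $\Omega$ in the generalized (Aleksandrov) sense, that is, $\lambda|E|\le\mathcal M u(E)\le\Lambda|E|$ for every Borel set $E\subset\Omega$. Let $$\Sigma_u=\Bigl\{x_0\in\Omega:\ u\Bigl(\frac{x+x_0}{2}\Bigr)\ge\frac{u(x)+u(x_0)}{2}\ \text{for some }x\in\Omega,\ x\ne x_0\Bigr\}$$ be the set of points at which $u$ is not strictly convex. Then for every nondegenerate line segment $L\subset\Sigma_u$ and every point $x_0$ in the relative interior of $L$, there are an open convex neighbourhood $U\subset\Omega$ of $x_0$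 and a convex function $v:U\to\mathbb R$ such that $v\not\equiv u$ on $U$; $v\le u$ on $U$ and $v(x_0)=u(x_0)$ (that is, $v$ touches $u$ from below at $x_0$); and $\det D^2v=\det D^2u$ in $U$ in the generalized sense, that is, $\mathcal M v(E)=\mathcal M u(E)$ for every Borel set $E\subset U$. -/

import Mathlib

open MeasureTheory Set

/-- The subgradient `∂u(x₀)` of `u : Ω → ℝ` at `x₀`: the slopes of the affine functions that
support `u` from below on all of `Ω` at `x₀`. -/
def subgradient {n : ℕ} (Ω : Set (EuclideanSpace ℝ (Fin n)))
    (u : EuclideanSpace ℝ (Fin n) → ℝ) (x₀ : EuclideanSpace ℝ (Fin n)) :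
    Set (EuclideanSpace ℝ (Fin n)) :=
  {p | ∀ x ∈ Ω, u x₀ + inner ℝ p (x - x₀) ≤ u x}

/-- The Monge-Ampère measure of `u : Ω → ℝ`, evaluated at a (Borel) set `E ⊆ Ω`:
the Lebesgue measure of `∂u(E) = ⋃ x ∈ E, ∂u(x)`. -/
noncomputable def mongeAmpere {n : ℕ} (Ω : Set (EuclideanSpace ℝ (Fin n)))
    (u : EuclideanSpace ℝ (Fin n) → ℝ) (E : Set (EuclideanSpace ℝ (Fin n))) : ENNReal :=
  volume (⋃ x ∈ E, subgradient Ω u x)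

/-- `λ ≤ det D²u ≤ Λ` on `Ω` in the generalized (Aleksandrov) sense:
`λ |E| ≤ ℳu(E) ≤ Λ |E|` for every Borel set `E ⊆ Ω`. -/
def MongeAmpereBounds {n : ℕ} (Ω : Set (EuclideanSpace ℝ (Fin n)))
    (u : EuclideanSpace ℝ (Fin n) → ℝ) (lam Lam : ℝ) : Prop :=
  ∀ E : Set (EuclideanSpace ℝ (Fin n)), MeasurableSet E → E ⊆ Ω →
    ENNReal.ofReal lam * volume E ≤ mongeAmpere Ω u E ∧
      mongeAmpere Ω u E ≤ ENNReal.ofReal Lam * volume E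

/-- `x₀` is a strictly convex point of `u : Ω → ℝ`. -/
def IsStrictlyConvexPoint {n : ℕ} (Ω : Set (EuclideanSpace ℝ (Fin n)))
    (u : EuclideanSpace ℝ (Fin n) → ℝ) (x₀ : EuclideanSpace ℝ (Fin n)) : Prop :=
  ∀ x ∈ Ω, x ≠ x₀ → u ((2 : ℝ)⁻¹ • (x + x₀)) < (u x + u x₀) / 2

/-- The set `Σ_u` of the points of `Ω` that are not strictly convex points of `u`. -/
def nonStrictlyConvexSet {n : ℕ} (Ω : Set (EuclideanSpace ℝ (Fin n)))
    (u : EuclideanSpace ℝ (Fin n) → ℝ) : Set (EuclideanSpace ℝ (Fin n)) :=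
  {x₀ ∈ Ω | ¬ IsStrictlyConvexPoint Ω u x₀}

/-- On the set `U`, the function `v` touches `u` from below at `x₀`. -/
def TouchesFromBelowAt {n : ℕ} (U : Set (EuclideanSpace ℝ (Fin n)))
    (v u : EuclideanSpace ℝ (Fin n) → ℝ) (x₀ : EuclideanSpace ℝ (Fin n)) : Prop :=
  (∀ x ∈ U, v x ≤ u x) ∧ v x₀ = u x₀

/-!
Let `x₀` be a point at which `u` is not strictly convex, and `ℓ` the affine function supporting `u`
at `x₀` along which strict convexity fails.

The contact set `{u = ℓ}` has no extreme point in `Ω` (Caffarelli). If `x₀` were one, tilting `ℓ`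
slightly by an affine function `ε g` would cut out sections `S` of depth comparable to that of `u`
at a point `z` which is, relative to the width of `S`, arbitrarily close to a supporting hyperplane
of `S`. Up to scaling, the slopes of `u` in `S` contain the polar body of `S` centred at `z`, while
the slopes in a half-size copy of `S` lie in the polar body centred well inside `S`. The first body
contains many disjoint translates of a quarter of the second (`mul_volume_polarAt_le`), so its
volume is much larger, which contradicts the two-sided bounds. Hence `u = ℓ` on a segment with `x₀`
in its interior, in the direction of a unit vector `e`.

Rescaling `u - ℓ` around `x₀` by the linear map that halves the directions orthogonal to `e` and
stretches `e` by a large factor gives a function `w` (`rescaled`). Convexity and `u = ℓ` on the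
segment give `w ≤ (u + ℓ) / 2 ≤ u` near `x₀`, with equality at `x₀`, while the Monge-Ampère measure
is multiplied by the square of a large determinant, so `ℳ w ≥ Λ |·| ≥ ℳ u`.

It remains to solve `ℳ v = ℳ u` with `w ≤ v ≤ u` in a small ball `U`, with `v = w` on its boundary
(`exists_mongeAmpere_eq_between`). Such a `v` minimizes `∫_U f dℳu + ∫ f*`, where `f*` is the
Legendre transform over the closed ball and the second integral runs over the slopes bounded by a
Lipschitz constant, among Lipschitz functions between the obstacles `w` and `u`. The derivative of
`∫ f*` in the direction `η` is `-∫ η dℳf`, since for almost every slope the Legendre transform is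
differentiable and its gradient is the unique point where the slope is attained. Hence `ℳ v ≤ ℳ u`
where `v < u` and `ℳ v ≥ ℳ u` where `v > w`. On the contact sets `{v = u}` and `{v = w}` the same
inequalities hold because the function that lies below has fewer slopes. Finally `v ≠ u`, because
the radius of `U` is chosen such that `w < u` at some boundary point.
-/

open Metric Filter Topology

/-! ### Subgradients of convex functions -/


section Subgradient

variable {n : ℕ} {Ω U : Set (EuclideanSpace ℝ (Fin n))} {u : EuclideanSpace ℝ (Fin n) → ℝ}
  {x : EuclideanSpace ℝ (Fin n)}

/-- An affine function that supports a convex function near a point supports it globally. -/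
theorem ConvexOn.subgradient_eq_of_isOpen (hu : ConvexOn ℝ Ω u) (hU : IsOpen U) (hUΩ : U ⊆ Ω)
    (hx : x ∈ U) : subgradient U u x = subgradient Ω u x := by
  refine Subset.antisymm (fun p hp y hy => ?_) fun p hp y hy => hp y (hUΩ hy)
  have hcont : Tendsto (fun t : ℝ => x + t • (y - x)) (𝓝[>] 0) (𝓝 x) := by
    have : Continuous fun t : ℝ => x + t • (y - x) := by fun_prop
    simpa using (this.tendsto 0).mono_left nhdsWithin_le_nhds
  obtain ⟨t, htU, ht0, ht1⟩ := ((hcont.eventually (hU.mem_nhds hx)).and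
    (Ioo_mem_nhdsGT (zero_lt_one (α := ℝ)))).exists
  have h1 := hp _ htU
  have h2 := hu.2 (hUΩ hx) hy (sub_nonneg.2 ht1.le) ht0.le (by ring)
  have h3 : (1 - t) • x + t • y = x + t • (y - x) := by module
  rw [h3] at h2
  simp only [add_sub_cancel_left, inner_smul_right, smul_eq_mul] at h1 h2
  have : t * (u x + inner ℝ p (y - x)) ≤ t * u y := by linarith
  exact le_of_mul_le_mul_left this ht0

theorem ConvexOn.mongeAmpere_eq_of_isOpen (hu : ConvexOn ℝ Ω u) (hU : IsOpen U) (hUΩ : U ⊆ Ω)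
    {A : Set (EuclideanSpace ℝ (Fin n))} (hA : A ⊆ U) : mongeAmpere U u A = mongeAmpere Ω u A := by
  unfold mongeAmpere
  congr 1
  exact iUnion₂_congr fun x hx => hu.subgradient_eq_of_isOpen hU hUΩ (hA hx)

/-- A convex function on an open set has a supporting affine function at every point. -/
theorem ConvexOn.subgradient_nonempty (hu : ConvexOn ℝ Ω u) (hΩ : IsOpen Ω) (hx : x ∈ Ω) :
    (subgradient Ω u x).Nonempty := by
  have hS : IsOpen {q : EuclideanSpace ℝ (Fin n) × ℝ | q.1 ∈ Ω ∧ u q.1 < q.2} := by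
    have hc : ContinuousOn (fun q : EuclideanSpace ℝ (Fin n) × ℝ => q.2 - u q.1)
        (Prod.fst ⁻¹' Ω) :=
      continuousOn_snd.sub ((hu.continuousOn hΩ).comp continuousOn_fst fun q hq => hq)
    convert hc.isOpen_inter_preimage (hΩ.preimage continuous_fst) isOpen_Ioi (t := Ioi 0) using 1
    ext q
    simp
  obtain ⟨f, hf⟩ := geometric_hahn_banach_open_point (x := (x, u x)) hu.convex_strict_epigraph hS
    (by simp)
  have hsplit : ∀ y t, f (y, t) = f (y, 0) + t * f (0, 1) := fun y t => by
    rw [← smul_eq_mul, ← map_smul, ← map_add]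
    simp
  have hc : f (0, 1) < 0 := by
    have := hf (x, u x + 1) ⟨hx, by simp⟩
    rw [hsplit, hsplit x (u x)] at this
    linarith
  refine ⟨(InnerProductSpace.toDual ℝ _).symm
    ((-f (0, 1))⁻¹ • f.comp (ContinuousLinearMap.inl ℝ _ ℝ)), fun y hy => ?_⟩
  rw [InnerProductSpace.toDual_symm_apply]
  have h1 : f (y, 0) - f (x, 0) ≤ (u y - u x) * (-f (0, 1)) := by
    refine le_of_forall_pos_le_add fun ε hε => ?_
    have := hf (y, u y + ε / -f (0, 1)) ⟨hy, by
      simpa using div_pos hε (neg_pos.2 hc)⟩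
    rw [hsplit, hsplit x (u x), add_mul, div_mul_eq_mul_div, mul_div_assoc,
      div_neg_self hc.ne] at this
    linarith
  have h2 : f (y - x, 0) = f (y, 0) - f (x, 0) := by
    rw [← map_sub]
    simp
  have h3 : (-f (0, 1))⁻¹ * (f (y, 0) - f (x, 0)) ≤ u y - u x := by
    rw [inv_mul_le_iff₀ (neg_pos.2 hc)]
    linarith
  simp only [smul_apply, ContinuousLinearMap.comp_apply,
    ContinuousLinearMap.inl_apply, smul_eq_mul, h2]
  linarith

end Subgradient

/-! ### Slices at extreme points -/

section Slice

variable {n : ℕ}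

/-- Compact convex pieces of a convex set that avoid an extreme point lie in one compact convex
subset avoiding it. -/
theorem exists_convex_isCompact_of_mem_extremePoints {ι : Type*}
    {K : Set (EuclideanSpace ℝ (Fin n))}
    {x : EuclideanSpace ℝ (Fin n)} (hK : Convex ℝ K) (hx : x ∈ K.extremePoints ℝ)
    (C : ι → Set (EuclideanSpace ℝ (Fin n)))
    (hCc : ∀ i, IsCompact (C i)) (hCx : ∀ i, Convex ℝ (C i)) (hCK : ∀ i, C i ⊆ K)
    (hxC : ∀ i, x ∉ C i) (s : Finset ι) :
    ∃ H : Set (EuclideanSpace ℝ (Fin n)), IsCompact H ∧ Convex ℝ H ∧ H ⊆ K ∧ x ∉ H ∧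
      ∀ i ∈ s, C i ⊆ H := by
  classical
  induction s using Finset.induction_on with
  | empty => exact ⟨∅, isCompact_empty, convex_empty, empty_subset _, by simp, by simp⟩
  | insert i s _ ih =>
    obtain ⟨H, hHc, hHx, hHK, hxH, hs⟩ := ih
    rcases H.eq_empty_or_nonempty with rfl | hHne
    · refine ⟨C i, hCc i, hCx i, hCK i, hxC i, fun j hj => ?_⟩
      rcases Finset.mem_insert.1 hj with rfl | hj
      · exact Subset.rfl
      · exact (hs j hj).trans (empty_subset _)
    rcases (C i).eq_empty_or_nonempty with hi | hCne
    · refine ⟨H, hHc, hHx, hHK, hxH, fun j hj => ?_⟩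
      rcases Finset.mem_insert.1 hj with rfl | hj
      · simp [hi]
      · exact hs j hj
    refine ⟨convexJoin ℝ H (C i), ?_, hHx.convexJoin (hCx i), convexJoin_subset hHK (hCK i) hK,
      fun hmem => ?_, fun j hj => ?_⟩
    · have : convexJoin ℝ H (C i) = (fun q : ℝ × EuclideanSpace ℝ (Fin n) ×
          EuclideanSpace ℝ (Fin n) => q.2.1 + q.1 • (q.2.2 - q.2.1)) '' (Icc 0 1 ×ˢ H ×ˢ C i) := by
        ext y
        simp only [mem_convexJoin, segment_eq_image', mem_image, mem_prod, Prod.exists]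
        constructor
        · rintro ⟨a, ha, b, hb, t, ht, rfl⟩
          exact ⟨t, a, b, ⟨ht, ha, hb⟩, rfl⟩
        · rintro ⟨t, a, b, ⟨ht, ha, hb⟩, rfl⟩
          exact ⟨a, ha, b, hb, t, ht, rfl⟩
      rw [this]
      exact (isCompact_Icc.prod (hHc.prod (hCc i))).image (by fun_prop)
    · obtain ⟨a, ha, b, hb, hab⟩ := mem_convexJoin.1 hmem
      rcases eq_or_ne x a with rfl | hxa
      · exact hxH ha
      rcases eq_or_ne x b with rfl | hxb
      · exact hxC i hb
      have := mem_openSegment_of_ne_left_right hxa.symm hxb.symm hab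
      exact hxa ((mem_extremePoints.1 hx).2 a (hHK ha) b (hCK i hb) this).1.symm
    · rcases Finset.mem_insert.1 hj with rfl | hj
      · exact subset_convexJoin_right hHne
      · exact (hs j hj).trans (subset_convexJoin_left hCne)

/-- An extreme point of a compact convex set is cut off from a sphere around it by a hyperplane. -/
theorem exists_inner_lt_of_mem_extremePoints {K : Set (EuclideanSpace ℝ (Fin n))}
    {x : EuclideanSpace ℝ (Fin n)} {r : ℝ} (hr : 0 < r) (hK : Convex ℝ K) (hKc : IsCompact K)
    (hx : x ∈ K.extremePoints ℝ) :
    ∃ (q : EuclideanSpace ℝ (Fin n)) (c : ℝ), c < inner ℝ q x ∧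
      ∀ y ∈ K ∩ sphere x r, inner ℝ q y < c := by
  let C : ↥(K ∩ sphere x r) → Set (EuclideanSpace ℝ (Fin n)) := fun a => K ∩ closedBall a (r / 2)
  have hxC : ∀ a, x ∉ C a := fun a ⟨_, h⟩ => by
    have ha := a.2.2
    rw [mem_sphere, dist_comm] at ha
    rw [mem_closedBall] at h
    linarith
  obtain ⟨s, hcov⟩ := (hKc.inter_right (isClosed_sphere (x := x) (ε := r))).elim_nhds_subcover'
    (fun a _ => ball a (r / 2)) fun a _ => ball_mem_nhds a (half_pos hr)
  obtain ⟨H, hHc, hHx, hHK, hxH, hsH⟩ := exists_convex_isCompact_of_mem_extremePoints hK hx C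
    (fun a => hKc.inter_right isClosed_closedBall) (fun a => hK.inter (convex_closedBall _ _))
    (fun a => inter_subset_left) hxC s
  obtain ⟨f, c, hfc, hcx⟩ := geometric_hahn_banach_closed_point hHx hHc.isClosed hxH
  refine ⟨(InnerProductSpace.toDual ℝ _).symm f, c, by simpa using hcx, fun y hy => ?_⟩
  rw [InnerProductSpace.toDual_symm_apply]
  obtain ⟨a, ha, hya⟩ := mem_iUnion₂.1 (hcov hy)
  exact hfc y (hsH a ha ⟨hy.1, ball_subset_closedBall hya⟩)

end Slice

/-! ### Sections of a convex function and their polar bodies -/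

section Polar

open scoped Pointwise

variable {n : ℕ} {Ω S : Set (EuclideanSpace ℝ (Fin n))} {u : EuclideanSpace ℝ (Fin n) → ℝ}

/-- The polar body of `S` with respect to the centre `x`. -/
def polarAt (S : Set (EuclideanSpace ℝ (Fin n))) (x : EuclideanSpace ℝ (Fin n)) :
    Set (EuclideanSpace ℝ (Fin n)) :=
  {q | ∀ s ∈ S, inner ℝ q (s - x) ≤ 1}

theorem isClosed_polarAt (S : Set (EuclideanSpace ℝ (Fin n))) (x : EuclideanSpace ℝ (Fin n)) :
    IsClosed (polarAt S x) := by
  have : polarAt S x = ⋂ s ∈ S, {q | inner ℝ q (s - x) ≤ 1} := by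
    ext q
    simp [polarAt]
  rw [this]
  exact isClosed_biInter fun s _ => isClosed_le (by fun_prop) continuous_const

/-- If `u` lies below an affine function exactly in the section `S`, every slope of the cone with
base `S` and vertex `(z, u z)` is a slope of `u` in `S`. -/
theorem ConvexOn.pow_mul_volume_polarAt_le (hu : ConvexOn ℝ Ω u) (hS : IsOpen S)
    (hSb : Bornology.IsBounded S) (hSΩ : closure S ⊆ Ω) (hcont : ContinuousOn u Ω)
    {k z : EuclideanSpace ℝ (Fin n)} {c H : ℝ} (hz : z ∈ S)
    (hH : 0 ≤ H) (hzH : u z = inner ℝ k z + c - H)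
    (hbd : ∀ y ∈ closure S, y ∉ S → inner ℝ k y + c ≤ u y) :
    ENNReal.ofReal H ^ n * volume (polarAt S z) ≤ mongeAmpere Ω u S := by
  have hsub : k +ᵥ H • polarAt S z ⊆ ⋃ m ∈ S, subgradient Ω u m := by
    rintro _ ⟨_, ⟨q, hq, rfl⟩, rfl⟩
    have hq' : ∀ y ∈ closure S, inner ℝ q (y - z) ≤ 1 := fun y hy =>
      closure_minimal (t := {y | inner ℝ q (y - z) ≤ 1}) hq
        (isClosed_le (by fun_prop) continuous_const) hy
    have hcs : IsCompact (closure S) := hSb.isCompact_closure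
    obtain ⟨m, hm, hmin⟩ := hcs.exists_isMinOn ⟨z, subset_closure hz⟩
      (f := fun y => u y - inner ℝ (k + H • q) y)
      ((hcont.mono hSΩ).sub (by fun_prop))
    -- If the minimum is attained on the boundary of `S`, it is attained at `z` as well.
    obtain ⟨m', hm'S, hm'⟩ : ∃ m' ∈ S, ∀ y ∈ S,
        u m' - inner ℝ (k + H • q) m' ≤ u y - inner ℝ (k + H • q) y := by
      by_cases hmS : m ∈ S
      · exact ⟨m, hmS, fun y hy => hmin (subset_closure hy)⟩
      · refine ⟨z, hz, fun y hy => le_trans ?_ (hmin (subset_closure hy))⟩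
        have h1 := hbd m hm hmS
        have h2 := mul_le_mul_of_nonneg_left (hq' m hm) hH
        simp only [inner_add_left, real_inner_smul_left, inner_sub_right] at h2 ⊢
        linarith
    refine mem_iUnion₂.2 ⟨m', hm'S, ?_⟩
    rw [← hu.subgradient_eq_of_isOpen hS (subset_closure.trans hSΩ) hm'S]
    intro y hy
    have := hm' y hy
    change u m' + inner ℝ (k + H • q) (y - m') ≤ u y
    rw [inner_sub_right]
    linarith
  calc ENNReal.ofReal H ^ n * volume (polarAt S z) = volume (k +ᵥ H • polarAt S z) := by
        rw [measure_vadd, Measure.addHaar_smul_of_nonneg _ hH, finrank_euclideanSpace_fin,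
          ENNReal.ofReal_pow hH]
    _ ≤ _ := measure_mono hsub

/-- If `u` stays within `H` below an affine function on the convex set `S`, the slopes of `u` on the
half-size copy of `S` lie in a dilate of a polar body of `S`. -/
theorem mongeAmpere_homothety_le (hSx : Convex ℝ S) (hSΩ : S ⊆ Ω)
    {k z : EuclideanSpace ℝ (Fin n)} {c H : ℝ} (hz : z ∈ S) (hH : 0 < H)
    (hlt : ∀ y ∈ S, u y ≤ inner ℝ k y + c) (hge : ∀ y ∈ S, inner ℝ k y + c - H ≤ u y) :
    mongeAmpere Ω u (AffineMap.homothety z (1 / 2 : ℝ) '' S) ≤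
      ENNReal.ofReal (2 * H) ^ n * volume (polarAt S z) := by
  have hsub : ⋃ m ∈ AffineMap.homothety z (1 / 2 : ℝ) '' S, subgradient Ω u m ⊆
      k +ᵥ (2 * H) • polarAt S z := by
    refine iUnion₂_subset ?_
    rintro _ ⟨s, hs, rfl⟩ p hp
    refine ⟨p - k, ⟨(2 * H)⁻¹ • (p - k), fun s' hs' => ?_, ?_⟩, by simp⟩
    · have hx : AffineMap.homothety z (1 / 2 : ℝ) s ∈ S := by
        have : AffineMap.homothety z (1 / 2 : ℝ) s = (1 / 2 : ℝ) • z + (1 / 2 : ℝ) • s := by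
          rw [AffineMap.homothety_apply, vsub_eq_sub, vadd_eq_add]
          module
        rw [this]
        exact hSx hz hs (by norm_num) (by norm_num) (by norm_num)
      have hy : (1 / 2 : ℝ) • s + (1 / 2 : ℝ) • s' ∈ S :=
        hSx hs hs' (by norm_num) (by norm_num) (by norm_num)
      have h1 := hp _ (hSΩ hy)
      have h2 := hlt _ hy
      have h3 := hge _ hx
      have h4 : (1 / 2 : ℝ) • s + (1 / 2 : ℝ) • s' - AffineMap.homothety z (1 / 2 : ℝ) s =
          (1 / 2 : ℝ) • (s' - z) := by
        rw [AffineMap.homothety_apply, vsub_eq_sub, vadd_eq_add]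
        module
      have h5 : inner ℝ k ((1 / 2 : ℝ) • s + (1 / 2 : ℝ) • s') =
          inner ℝ k (AffineMap.homothety z (1 / 2 : ℝ) s) + (1 / 2) * inner ℝ k (s' - z) := by
        rw [← inner_smul_right, ← inner_add_right, ← h4, add_sub_cancel]
      rw [h4, inner_smul_right] at h1
      rw [real_inner_smul_left, inv_mul_le_iff₀ (by positivity), inner_sub_left]
      linarith
    · exact smul_inv_smul₀ (by positivity) _
  refine (measure_mono hsub).trans_eq ?_
  rw [measure_vadd, Measure.addHaar_smul_of_nonneg _ (by positivity), finrank_euclideanSpace_fin,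
    ENNReal.ofReal_pow (by positivity)]

/-- The polar body of `S` centred at a point `x` almost maximizing `⟨q, ·⟩` on `S` contains many
disjoint translates, in the direction `q`, of a quarter of a polar body centred deeper in `S`. -/
theorem mul_volume_polarAt_le {q x y : EuclideanSpace ℝ (Fin n)} {b δ : ℝ} {N : ℕ}
    (hx : x ∈ S) (hy : y ∈ S) (hb : 0 < b) (hδ : 0 ≤ δ) (hN : N * δ ≤ b / 2)
    (hqx : ∀ s ∈ S, inner ℝ q (s - x) ≤ δ)
    (hqb : inner ℝ q (x - (2⁻¹ : ℝ) • (x + y)) = b) :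
    (N : ENNReal) * (ENNReal.ofReal (1 / 4) ^ n * volume (polarAt S ((2⁻¹ : ℝ) • (x + y)))) ≤
      volume (polarAt S x) := by
  set z := (2⁻¹ : ℝ) • (x + y) with hz
  let A : ℕ → Set (EuclideanSpace ℝ (Fin n)) := fun j => (j / b) • q +ᵥ (1 / 4 : ℝ) • polarAt S z
  have hyz : y - z = -(x - z) := by
    rw [hz]
    module
  have hmem : ∀ j p, p ∈ A j → ∃ p' ∈ polarAt S z, p = (j / b) • q + (1 / 4 : ℝ) • p' := by
    rintro j _ ⟨_, ⟨p', hp', rfl⟩, rfl⟩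
    exact ⟨p', hp', rfl⟩
  have hwidth : ∀ p' ∈ polarAt S z, |inner ℝ p' (x - z)| ≤ 1 := fun p' hp' => by
    have h2 := hp' y hy
    rw [hyz, inner_neg_right] at h2
    exact abs_le.2 ⟨by linarith, hp' x hx⟩
  have hvol : ∀ j, volume (A j) = ENNReal.ofReal (1 / 4) ^ n * volume (polarAt S z) := fun j => by
    rw [measure_vadd, Measure.addHaar_smul_of_nonneg _ (by norm_num), finrank_euclideanSpace_fin,
      ENNReal.ofReal_pow (by norm_num)]
  have hmeas : ∀ j, MeasurableSet (A j) := fun j =>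
    ((isClosed_polarAt S z).measurableSet.const_smul₀ _).const_vadd _
  -- The translates are separated by the functional `⟨·, x - z⟩`.
  have hdisj : Pairwise (Function.onFun Disjoint A) := by
    intro i j hij
    refine Set.disjoint_left.2 fun p hpi hpj => hij ?_
    obtain ⟨p₁, hp₁, rfl⟩ := hmem i p hpi
    obtain ⟨p₂, hp₂, h⟩ := hmem j _ hpj
    have h' := congrArg (fun v => inner ℝ v (x - z)) h
    simp only [inner_add_left, real_inner_smul_left, hqb, div_mul_cancel₀ _ hb.ne'] at h'
    have h1 := abs_le.1 (hwidth p₁ hp₁)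
    have h2 := abs_le.1 (hwidth p₂ hp₂)
    have h3 : (i : ℝ) < j + 1 := by linarith
    have h4 : (j : ℝ) < i + 1 := by linarith
    have h3' : i < j + 1 := by exact_mod_cast h3
    have h4' : j < i + 1 := by exact_mod_cast h4
    omega
  have hsub : ⋃ j ∈ Finset.range N, A j ⊆ polarAt S x := by
    refine iUnion₂_subset fun j hj p hp s hs => ?_
    obtain ⟨p', hp', rfl⟩ := hmem j p hp
    have hjN : (j : ℝ) ≤ N := by exact_mod_cast (Finset.mem_range.1 hj).le
    have h1 := hp' s hs
    have h2 := hp' y hy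
    have h3 : (j / b) * inner ℝ q (s - x) ≤ 1 / 2 := by
      refine (mul_le_mul_of_nonneg_left (hqx s hs) (by positivity)).trans ?_
      rw [div_mul_eq_mul_div, div_le_iff₀ hb]
      nlinarith
    have h4 : s - x = (s - z) + (y - z) := by
      rw [hz]
      module
    have h5 : inner ℝ p' (s - x) = inner ℝ p' (s - z) + inner ℝ p' (y - z) := by
      rw [h4, inner_add_right]
    rw [inner_add_left, real_inner_smul_left, real_inner_smul_left, h5]
    linarith
  calc (N : ENNReal) * (ENNReal.ofReal (1 / 4) ^ n * volume (polarAt S z))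
      = volume (⋃ j ∈ Finset.range N, A j) := by
        rw [measure_biUnion_finset (fun i _ j _ hij => hdisj hij) fun j _ => hmeas j]
        simp [hvol]
    _ ≤ _ := measure_mono hsub

end Polar

/-! ### Contact sets have no extreme points -/

section Contact

variable {n : ℕ} {Ω : Set (EuclideanSpace ℝ (Fin n))} {u : EuclideanSpace ℝ (Fin n) → ℝ}
  {lam Lam : ℝ}

/-- The set where `u` coincides with the affine function of slope `p` that touches it at `x₀`. -/
def contactSet (Ω : Set (EuclideanSpace ℝ (Fin n))) (u : EuclideanSpace ℝ (Fin n) → ℝ)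
    (p x₀ : EuclideanSpace ℝ (Fin n)) : Set (EuclideanSpace ℝ (Fin n)) :=
  {y ∈ Ω | u y = u x₀ + inner ℝ p (y - x₀)}

theorem ConvexOn.convex_contactSet (hu : ConvexOn ℝ Ω u) {p x₀ : EuclideanSpace ℝ (Fin n)}
    (hp : p ∈ subgradient Ω u x₀) : Convex ℝ (contactSet Ω u p x₀) := by
  intro y hy z hz a b ha hb hab
  have hmem := hu.1 hy.1 hz.1 ha hb hab
  refine ⟨hmem, le_antisymm ?_ (hp _ hmem)⟩
  have h1 := hu.2 hy.1 hz.1 ha hb hab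
  have h2 : a • y + b • z - x₀ = a • (y - x₀) + b • (z - x₀) := by
    have : x₀ = (a + b) • x₀ := by rw [hab, one_smul]
    nth_rewrite 1 [this]
    module
  rw [hy.2, hz.2, smul_eq_mul, smul_eq_mul] at h1
  rw [h2, inner_add_right, inner_smul_right, inner_smul_right]
  have h3 : u x₀ = a * u x₀ + b * u x₀ := by rw [← add_mul, hab, one_mul]
  linarith

theorem exists_pos_mul_lt_of_isCompact {X : Type*} [TopologicalSpace X] {Q : Set X}
    (hQ : IsCompact Q) {f g : X → ℝ} (hf : ContinuousOn f Q) (hg : ContinuousOn g Q)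
    (hpos : ∀ y ∈ Q, 0 < f y) : ∃ ε > 0, ∀ y ∈ Q, ε * g y < f y := by
  rcases Q.eq_empty_or_nonempty with rfl | hne
  · exact ⟨1, one_pos, by simp⟩
  obtain ⟨m, hm, hmin⟩ := hQ.exists_isMinOn hne hf
  obtain ⟨M, hM, hmax⟩ := hQ.exists_isMaxOn hne hg
  have hden : 0 < |g M| + 1 := by positivity
  have hε : 0 < f m / (|g M| + 1) := div_pos (hpos m hm) hden
  refine ⟨_, hε, fun y hy => ?_⟩
  calc f m / (|g M| + 1) * g y < f m / (|g M| + 1) * (|g M| + 1) := by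
        have h1 : g y ≤ g M := hmax hy
        exact mul_lt_mul_of_pos_left (by linarith [le_abs_self (g M)]) hε
    _ = f m := div_mul_cancel₀ _ hden.ne'
    _ ≤ f y := hmin hy

/-- If a contact set has the extreme point `x₀` and another point, tilting its supporting plane
slightly cuts out sections in which the maximal tilt is attained arbitrarily close, relative to
the depth of the section, to a supporting hyperplane of the section. -/
theorem ConvexOn.exists_section_of_mem_extremePoints (hΩ : IsOpen Ω) (hu : ConvexOn ℝ Ω u)
    {p x₀ x : EuclideanSpace ℝ (Fin n)} (hp : p ∈ subgradient Ω u x₀)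
    (hx : x ∈ contactSet Ω u p x₀) (hxx₀ : x ≠ x₀)
    (hext : x₀ ∈ (contactSet Ω u p x₀).extremePoints ℝ) {N : ℕ} (hN : 0 < N) :
    ∃ (S : Set (EuclideanSpace ℝ (Fin n))) (k q z y : EuclideanSpace ℝ (Fin n)) (c a H : ℝ),
      IsOpen S ∧ Convex ℝ S ∧ Bornology.IsBounded S ∧ closure S ⊆ Ω ∧ z ∈ S ∧ y ∈ S ∧
      0 < H ∧ 0 < a ∧ u z = inner ℝ k z + c - H ∧
      (∀ s ∈ closure S, s ∉ S → inner ℝ k s + c ≤ u s) ∧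
      (∀ s ∈ S, u s ≤ inner ℝ k s + c) ∧ (∀ s ∈ S, inner ℝ k s + c - 2 * H ≤ u s) ∧
      (∀ s ∈ S, inner ℝ q (s - z) ≤ a / (8 * N)) ∧
      inner ℝ q (z - (2⁻¹ : ℝ) • (z + y)) = a / 4 := by
  obtain ⟨r₀, hr₀, hball⟩ := nhds_basis_closedBall.mem_iff.1
    (hΩ.mem_nhds (extremePoints_subset hext).1)
  set r := min r₀ (dist x x₀) with hr_def
  have hr : 0 < r := lt_min hr₀ (dist_pos.2 hxx₀)
  have hBΩ : closedBall x₀ r ⊆ Ω := (closedBall_subset_closedBall (min_le_left _ _)).trans hball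
  have hcont := hu.continuousOn hΩ
  let ut : EuclideanSpace ℝ (Fin n) → ℝ := fun y => u y - (u x₀ + inner ℝ p (y - x₀))
  have hut : ContinuousOn ut Ω := hcont.sub (by fun_prop)
  have hut0 : ∀ y ∈ Ω, 0 ≤ ut y := fun y hy => sub_nonneg.2 (hp y hy)
  have hutK : ∀ y, y ∈ contactSet Ω u p x₀ ↔ y ∈ Ω ∧ ut y = 0 := fun y =>
    and_congr_right fun _ => sub_eq_zero.symm
  have hKx := hu.convex_contactSet hp
  set K := contactSet Ω u p x₀ with hK
  have hKc : IsCompact (K ∩ closedBall x₀ r) := by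
    have h1 : IsClosed (closedBall x₀ r ∩ ut ⁻¹' {0}) :=
      (hut.mono hBΩ).preimage_isClosed_of_isClosed isClosed_closedBall isClosed_singleton
    have h2 : K ∩ closedBall x₀ r = closedBall x₀ r ∩ ut ⁻¹' {0} := by
      ext y
      simp only [mem_inter_iff, hutK, mem_preimage, mem_singleton_iff]
      exact ⟨fun h => ⟨h.2, h.1.2⟩, fun h => ⟨⟨hBΩ h.1, h.2⟩, h.1⟩⟩
    rw [h2]
    exact (isCompact_closedBall x₀ r).of_isClosed_subset h1 inter_subset_left
  have hx₀K : x₀ ∈ K ∩ closedBall x₀ r := ⟨extremePoints_subset hext, mem_closedBall_self hr.le⟩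
  have hext' : x₀ ∈ (K ∩ closedBall x₀ r).extremePoints ℝ :=
    inter_extremePoints_subset_extremePoints_of_subset inter_subset_left ⟨hx₀K, hext⟩
  obtain ⟨q, c, hqx₀, hqA⟩ := exists_inner_lt_of_mem_extremePoints hr
    (hKx.inter (convex_closedBall x₀ r)) hKc hext'
  have hqA' : ∀ y ∈ K, dist y x₀ = r → inner ℝ q y < c := fun y hy hd =>
    hqA y ⟨⟨hy, mem_closedBall.2 hd.le⟩, hd⟩
  obtain ⟨z, hz, hzmax⟩ := hKc.exists_isMaxOn ⟨x₀, hx₀K⟩ (f := fun y => inner ℝ q y - c)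
    (by fun_prop)
  set a := inner ℝ q z - c with ha_def
  have ha : 0 < a := lt_of_lt_of_le (sub_pos.2 hqx₀) (hzmax hx₀K)
  have hNpos : (0 : ℝ) < N := by exact_mod_cast hN
  -- the tilt changes sign between `z` and a point where the contact set leaves the ball
  obtain ⟨y₀, hy₀, hqy₀⟩ : ∃ y₀ ∈ K ∩ closedBall x₀ r, inner ℝ q y₀ = c := by
    have hd : 0 < dist x x₀ := dist_pos.2 hxx₀
    have hsphere : AffineMap.lineMap x₀ x (r / dist x x₀) ∈ K ∩ closedBall x₀ r ∧
        inner ℝ q (AffineMap.lineMap x₀ x (r / dist x x₀)) < c := by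
      have h1 : dist (AffineMap.lineMap x₀ x (r / dist x x₀)) x₀ = r := by
        rw [dist_lineMap_left, Real.norm_of_nonneg (by positivity), dist_comm x₀ x,
          div_mul_cancel₀ _ hd.ne']
      have h2 : AffineMap.lineMap x₀ x (r / dist x x₀) ∈ K :=
        hKx.lineMap_mem hx₀K.1 hx ⟨by positivity, (div_le_one hd).2 (min_le_right _ _)⟩
      exact ⟨⟨h2, mem_closedBall.2 h1.le⟩, hqA' _ h2 h1⟩
    have hpre : IsPreconnected (K ∩ closedBall x₀ r) :=
      (hKx.inter (convex_closedBall x₀ r)).isPreconnected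
    obtain ⟨y₀, hy₀, h⟩ := hpre.intermediate_value hsphere.1 hx₀K
      (f := fun y => inner ℝ q y) (by fun_prop) ⟨hsphere.2.le, hqx₀.le⟩
    exact ⟨y₀, hy₀, h⟩
  set Q : Set (EuclideanSpace ℝ (Fin n)) := closedBall x₀ r ∩
    (({y | c ≤ inner ℝ q y} ∩ sphere x₀ r) ∪ {y | c + (a + a / (8 * N)) ≤ inner ℝ q y}) with hQ
  have hQc : IsCompact Q := (isCompact_closedBall x₀ r).inter_right
    (((isClosed_le continuous_const (by fun_prop)).inter isClosed_sphere).union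
      (isClosed_le continuous_const (by fun_prop)))
  have hQpos : ∀ y ∈ Q, 0 < ut y := by
    rintro y ⟨hyB, hy⟩
    refine lt_of_le_of_ne (hut0 y (hBΩ hyB)) fun h0 => ?_
    have hyK : y ∈ K := (hutK y).2 ⟨hBΩ hyB, h0.symm⟩
    rcases hy with ⟨hy1, hy2⟩ | hy
    · exact absurd (hqA' y hyK hy2) (not_lt.2 hy1)
    · have h1 : inner ℝ q y - c ≤ a := hzmax ⟨hyK, hyB⟩
      have h2 : 0 < a / (8 * N) := by positivity
      have h3 : c + (a + a / (8 * N)) ≤ inner ℝ q y := hy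
      linarith
  obtain ⟨ε, hε, hεQ⟩ := exists_pos_mul_lt_of_isCompact hQc
    (hut.mono (inter_subset_left.trans hBΩ)) (g := fun y => inner ℝ q y - c) (by fun_prop) hQpos
  have hform : ∀ y, inner ℝ (p + ε • q) y + (u x₀ - inner ℝ p x₀ - ε * c) =
      u y - ut y + ε * (inner ℝ q y - c) := fun y => by
    simp only [ut, inner_add_left, real_inner_smul_left, inner_sub_right]
    ring
  set S : Set (EuclideanSpace ℝ (Fin n)) :=
    ball x₀ r ∩ {y | ut y - ε * (inner ℝ q y - c) < 0} with hS
  have hSball : S ⊆ closedBall x₀ r := inter_subset_left.trans ball_subset_closedBall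
  have hSclosure : closure S ⊆ closedBall x₀ r := closure_minimal hSball isClosed_closedBall
  have hSbound : ∀ s ∈ S, inner ℝ q s - c < a + a / (8 * N) := by
    rintro s ⟨hsB, hs⟩
    by_contra! h
    have := hεQ s ⟨ball_subset_closedBall hsB, Or.inr (by
      change c + (a + a / (8 * N)) ≤ inner ℝ q s
      linarith)⟩
    have hs' : ut s - ε * (inner ℝ q s - c) < 0 := hs
    linarith
  have hKS : ∀ y ∈ K ∩ closedBall x₀ r, 0 < inner ℝ q y - c → y ∈ S := by
    intro y hy hyq
    refine ⟨mem_ball.2 (lt_of_le_of_ne (mem_closedBall.1 hy.2) fun hd => ?_), ?_⟩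
    · linarith [hqA' y hy.1 hd]
    · change ut y - ε * (inner ℝ q y - c) < 0
      rw [((hutK y).1 hy.1).2]
      linarith [mul_pos hε hyq]
  have hy₁K : (2⁻¹ : ℝ) • z + (2⁻¹ : ℝ) • y₀ ∈ K ∩ closedBall x₀ r :=
    (hKx.inter (convex_closedBall x₀ r)) hz hy₀ (by norm_num) (by norm_num) (by norm_num)
  have hqz : inner ℝ q z = a + c := by rw [ha_def]; ring
  have hqy₁ : inner ℝ q ((2⁻¹ : ℝ) • z + (2⁻¹ : ℝ) • y₀) = a / 2 + c := by
    rw [inner_add_right, inner_smul_right, inner_smul_right, hqy₀, hqz]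
    ring
  have hfrac : a / (8 * N) ≤ a := div_le_self ha.le (by
    have : (1 : ℝ) ≤ N := by exact_mod_cast hN
    linarith)
  refine ⟨S, p + ε • q, q, z, (2⁻¹ : ℝ) • z + (2⁻¹ : ℝ) • y₀, u x₀ - inner ℝ p x₀ - ε * c, a,
    ε * a, ?_, ?_, isBounded_ball.subset inter_subset_left, hSclosure.trans hBΩ, hKS z hz ha,
    hKS _ hy₁K (by rw [hqy₁]; linarith), mul_pos hε ha, ha, ?_, ?_, ?_, ?_, ?_, ?_⟩
  · have hc : ContinuousOn (fun y => ut y - ε * (inner ℝ q y - c)) (ball x₀ r) :=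
      (hut.mono (ball_subset_closedBall.trans hBΩ)).sub (by fun_prop)
    exact hc.isOpen_inter_preimage isOpen_ball isOpen_Iio
  · have h1 : ConvexOn ℝ (ball x₀ r)
        (fun y => u y - (inner ℝ (p + ε • q) y + (u x₀ - inner ℝ p x₀ - ε * c))) := by
      refine (hu.subset (ball_subset_closedBall.trans hBΩ) (convex_ball x₀ r)).sub ?_
      refine ConcaveOn.add ?_ (concaveOn_const _ (convex_ball x₀ r))
      exact ((innerSL ℝ (p + ε • q)).toLinearMap.concaveOn (convex_ball x₀ r))
    have h2 : S = {y ∈ ball x₀ r |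
        u y - (inner ℝ (p + ε • q) y + (u x₀ - inner ℝ p x₀ - ε * c)) < 0} := by
      ext y
      refine and_congr_right fun _ => ?_
      rw [hform]
      change ut y - ε * (inner ℝ q y - c) < 0 ↔ _
      constructor <;> intro h <;> linarith
    rw [h2]
    exact h1.convex_lt 0
  · rw [hform, ((hutK z).1 hz.1).2, ← ha_def]
    ring
  · intro s hs hsS
    rw [hform]
    have hsB := hSclosure hs
    rcases eq_or_ne (dist s x₀) r with hd | hd
    · rcases lt_or_ge (inner ℝ q s) c with hlt | hge
      · have := hut0 s (hBΩ hsB)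
        nlinarith
      · have := hεQ s ⟨hsB, Or.inl ⟨hge, hd⟩⟩
        linarith
    · have hsb : s ∈ ball x₀ r := lt_of_le_of_ne hsB hd
      have : ¬ (ut s - ε * (inner ℝ q s - c) < 0) := fun h => hsS ⟨hsb, h⟩
      linarith
  · rintro s ⟨-, hs⟩
    rw [hform]
    have hs' : ut s - ε * (inner ℝ q s - c) < 0 := hs
    linarith
  · intro s hs
    rw [hform]
    have h1 := hSbound s hs
    have h2 := hut0 s (hBΩ (hSball hs))
    have h3 : ε * (inner ℝ q s - c) ≤ ε * (2 * a) :=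
      mul_le_mul_of_nonneg_left (by linarith) hε.le
    linarith
  · intro s hs
    have h1 := hSbound s hs
    rw [inner_sub_right, hqz]
    linarith
  · rw [inner_sub_right, inner_smul_right, inner_add_right, hqy₁, hqz]
    ring

/-- Caffarelli's theorem: under two-sided bounds on the Monge-Ampère measure, a contact set with
more than one point has no extreme point inside the domain. -/
theorem MongeAmpereBounds.notMem_extremePoints (hMA : MongeAmpereBounds Ω u lam Lam)
    (hΩ : IsOpen Ω) (hu : ConvexOn ℝ Ω u) (hlam : 0 < lam)
    {p x₀ x : EuclideanSpace ℝ (Fin n)} (hp : p ∈ subgradient Ω u x₀)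
    (hx : x ∈ contactSet Ω u p x₀) (hxx₀ : x ≠ x₀) :
    x₀ ∉ (contactSet Ω u p x₀).extremePoints ℝ := by
  intro hext
  -- Comparing the slopes in a section `S` with those in its half-size copy costs a factor `16 ^ n`,
  -- and the copy has volume `(1 / 2) ^ n * |S|`; `N` disjoint translates of polar bodies beat both.
  obtain ⟨N, hN⟩ := exists_nat_gt (max 0 (16 ^ n * Lam / (lam * (1 / 2) ^ n)))
  have hN0 : 0 < N := by exact_mod_cast (le_max_left _ _).trans_lt hN
  have hN' : 16 ^ n * Lam < N * (lam * (1 / 2) ^ n) :=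
    (div_lt_iff₀ (by positivity)).1 ((le_max_right _ _).trans_lt hN)
  obtain ⟨S, k, q, z, y, c, a, H, hSo, hSx, hSb, hSΩ, hz, hy, hH, ha, hzH, hbd, hlt, hge, hq,
      hqb⟩ :=
    hu.exists_section_of_mem_extremePoints hΩ hp hx hxx₀ hext hN0
  have hcont := hu.continuousOn hΩ
  have hSΩ' : S ⊆ Ω := subset_closure.trans hSΩ
  have hNpos : (0 : ℝ) < N := by exact_mod_cast hN0
  set m := (2⁻¹ : ℝ) • (z + y) with hm
  have hmS : m ∈ S := by
    rw [hm, smul_add]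
    exact hSx hz hy (by norm_num) (by norm_num) (by norm_num)
  have h1 := hu.pow_mul_volume_polarAt_le hSo hSb hSΩ hcont hz hH.le hzH hbd
  have h2 := (hMA S hSo.measurableSet hSΩ').2
  have hhalf : AffineMap.homothety m (1 / 2 : ℝ) '' S ⊆ S := by
    rintro _ ⟨s, hs, rfl⟩
    have : AffineMap.homothety m (1 / 2 : ℝ) s = (1 / 2 : ℝ) • m + (1 / 2 : ℝ) • s := by
      rw [AffineMap.homothety_apply, vsub_eq_sub, vadd_eq_add]
      module
    rw [this]
    exact hSx hmS hs (by norm_num) (by norm_num) (by norm_num)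
  have hhalfm : MeasurableSet (AffineMap.homothety m (1 / 2 : ℝ) '' S) :=
    (AffineMap.homothety_isOpenMap m (1 / 2 : ℝ) (by norm_num) S hSo).measurableSet
  have h3 := (hMA _ hhalfm (hhalf.trans hSΩ')).1
  have h4 := mongeAmpere_homothety_le (u := u) hSx hSΩ' hmS (H := 2 * H) (by positivity) hlt hge
  have h5 := mul_volume_polarAt_le (N := N) hz hy (b := a / 4) (δ := a / (8 * N)) (by positivity)
    (by positivity) (le_of_eq (by field_simp; norm_num)) hq hqb
  rw [← hm] at h5
  rw [Measure.addHaar_image_homothety, finrank_euclideanSpace_fin,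
    abs_of_nonneg (by positivity)] at h3
  have hV0 : volume S ≠ 0 := (hSo.measure_pos volume ⟨z, hz⟩).ne'
  have hVtop : volume S ≠ ⊤ := hSb.measure_lt_top.ne
  have h16 : ENNReal.ofReal (2 * (2 * H)) ^ n =
      ENNReal.ofReal (16 ^ n) * ENNReal.ofReal H ^ n * ENNReal.ofReal (1 / 4) ^ n := by
    rw [ENNReal.ofReal_pow (by norm_num), ← mul_pow, ← mul_pow,
      ← ENNReal.ofReal_mul (by norm_num), ← ENNReal.ofReal_mul (by positivity)]
    congr 2
    ring
  have key : ENNReal.ofReal (N * (lam * (1 / 2) ^ n)) * volume S ≤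
      ENNReal.ofReal (16 ^ n * Lam) * volume S := by
    calc ENNReal.ofReal (N * (lam * (1 / 2) ^ n)) * volume S
        = N * (ENNReal.ofReal lam * (ENNReal.ofReal ((1 / 2) ^ n) * volume S)) := by
          rw [ENNReal.ofReal_mul (by positivity), ENNReal.ofReal_mul hlam.le,
            ENNReal.ofReal_natCast]
          ring
      _ ≤ N * (ENNReal.ofReal (2 * (2 * H)) ^ n * volume (polarAt S m)) := by
          exact mul_le_mul_right (h3.trans h4) _
      _ = ENNReal.ofReal (16 ^ n) * (ENNReal.ofReal H ^ n *
            (N * (ENNReal.ofReal (1 / 4) ^ n * volume (polarAt S m)))) := by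
          rw [h16]
          ring
      _ ≤ ENNReal.ofReal (16 ^ n) * (ENNReal.ofReal Lam * volume S) := by
          exact mul_le_mul_right ((mul_le_mul_right h5 _).trans (h1.trans h2)) _
      _ = ENNReal.ofReal (16 ^ n * Lam) * volume S := by
          rw [ENNReal.ofReal_mul (by positivity)]
          ring
  have := (ENNReal.mul_le_mul_iff_left hV0 hVtop).1 key
  exact absurd this (not_le.2 ((ENNReal.ofReal_lt_ofReal_iff (by positivity)).2 hN'))

/-- Every point at which `u` is not strictly convex lies in the interior of a segment along which
`u` is affine. -/
theorem MongeAmpereBounds.exists_affine_segment (hMA : MongeAmpereBounds Ω u lam Lam)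
    (hΩ : IsOpen Ω) (hu : ConvexOn ℝ Ω u) (hlam : 0 < lam) {x₀ : EuclideanSpace ℝ (Fin n)}
    (hx₀ : x₀ ∈ nonStrictlyConvexSet Ω u) :
    ∃ p ∈ subgradient Ω u x₀, ∃ e : EuclideanSpace ℝ (Fin n), ‖e‖ = 1 ∧ ∃ ρ > 0,
      ∀ t : ℝ, |t| ≤ ρ → x₀ + t • e ∈ contactSet Ω u p x₀ := by
  obtain ⟨hx₀Ω, hnot⟩ := hx₀
  simp only [IsStrictlyConvexPoint, not_forall, not_lt] at hnot
  obtain ⟨x, hxΩ, hxx₀, hmid⟩ := hnot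
  set m := (2 : ℝ)⁻¹ • (x + x₀) with hm
  have hmΩ : m ∈ Ω := by
    rw [hm, smul_add]
    exact hu.1 hxΩ hx₀Ω (by norm_num) (by norm_num) (by norm_num)
  obtain ⟨p, hp⟩ := hu.subgradient_nonempty hΩ hmΩ
  have h1 := hp x hxΩ
  have h2 := hp x₀ hx₀Ω
  have h3 : inner ℝ p (x - m) + inner ℝ p (x₀ - m) = (0 : ℝ) := by
    rw [← inner_add_right]
    have : x - m + (x₀ - m) = 0 := by
      rw [hm]
      module
    rw [this, inner_zero_right]
  have h4 : u x₀ = u m + inner ℝ p (x₀ - m) := by linarith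
  have h5 : u x = u m + inner ℝ p (x - m) := by linarith
  have hsub : ∀ y, u x₀ + inner ℝ p (y - x₀) = u m + inner ℝ p (y - m) := fun y => by
    rw [h4, add_assoc, ← inner_add_right]
    congr 2
    abel
  have hp₀ : p ∈ subgradient Ω u x₀ := fun y hy => by
    rw [hsub]
    exact hp y hy
  have hx : x ∈ contactSet Ω u p x₀ := ⟨hxΩ, by rw [hsub, h5]⟩
  have hx₀K : x₀ ∈ contactSet Ω u p x₀ := ⟨hx₀Ω, by simp⟩
  have hKx := hu.convex_contactSet hp₀
  have hnext := hMA.notMem_extremePoints hΩ hu hlam hp₀ hx hxx₀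
  refine ⟨p, hp₀, ?_⟩
  obtain ⟨y, hy, z, hz, hyz, hne⟩ : ∃ y ∈ contactSet Ω u p x₀, ∃ z ∈ contactSet Ω u p x₀,
      x₀ ∈ openSegment ℝ y z ∧ y ≠ x₀ := by
    by_contra! h
    refine hnext (mem_extremePoints.2 ⟨hx₀K, fun y hy z hz hyz => ⟨h y hy z hz hyz, ?_⟩⟩)
    exact h z hz y hy (openSegment_symm ℝ y z ▸ hyz)
  obtain ⟨α, β, hα, hβ, hαβ, hx₀eq⟩ := hyz
  have hv : 0 < ‖y - x₀‖ := norm_pos_iff.2 (sub_ne_zero.2 hne)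
  refine ⟨‖y - x₀‖⁻¹ • (y - x₀), by rw [norm_smul, norm_inv, norm_norm, inv_mul_cancel₀ hv.ne'],
    ‖y - x₀‖ * min 1 (α / β), by positivity, fun t ht => ?_⟩
  set τ := t * ‖y - x₀‖⁻¹ with hτ
  have hτt : |τ| ≤ min 1 (α / β) := by
    rw [hτ, abs_mul, abs_inv, abs_norm, ← div_eq_mul_inv, div_le_iff₀ hv, mul_comm]
    exact ht
  rw [smul_smul, ← hτ]
  rcases le_total 0 τ with h0 | h0
  · rw [abs_of_nonneg h0] at hτt
    exact hKx.add_smul_sub_mem hx₀K hy ⟨h0, hτt.trans (min_le_left _ _)⟩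
  · rw [abs_of_nonpos h0] at hτt
    have h6 : -τ * β / α ≤ 1 := by
      have := (le_div_iff₀ hβ).1 (hτt.trans (min_le_right _ _))
      rwa [div_le_one hα]
    have h7 : x₀ + τ • (y - x₀) = x₀ + (-τ * β / α) • (z - x₀) := by
      have h8 : α • (y - x₀) = -(β • (z - x₀)) := by
        have h9 : α • (y - x₀) + β • (z - x₀) = (α • y + β • z) - (α + β) • x₀ := by module
        rw [hx₀eq, hαβ, one_smul, sub_self] at h9
        exact eq_neg_of_add_eq_zero_left h9
      have h10 : y - x₀ = α⁻¹ • -(β • (z - x₀)) := by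
        rw [← h8, inv_smul_smul₀ hα.ne']
      rw [h10, div_eq_mul_inv]
      module
    rw [h7]
    exact hKx.add_smul_sub_mem hx₀K hz ⟨by
      have : 0 ≤ -τ := neg_nonneg.2 h0
      positivity, h6⟩

end Contact

/-! ### Legendre transforms over compact sets -/

section Conjugate

open scoped NNReal Gradient

variable {n : ℕ} {K D : Set (EuclideanSpace ℝ (Fin n))} {f g : EuclideanSpace ℝ (Fin n) → ℝ}
  {p x : EuclideanSpace ℝ (Fin n)}

/-- The Legendre transform `p ↦ sup_{x ∈ K} (⟨p, x⟩ - f x)` of `f` restricted to `K`. It is used for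
compact nonempty `K` and `f` continuous on `K`, where the supremum is attained. -/
noncomputable def conjOn (K : Set (EuclideanSpace ℝ (Fin n)))
    (f : EuclideanSpace ℝ (Fin n) → ℝ) (p : EuclideanSpace ℝ (Fin n)) : ℝ :=
  sSup ((fun x => inner ℝ p x - f x) '' K)

theorem exists_conjOn_eq (hK : IsCompact K) (hne : K.Nonempty) (hf : ContinuousOn f K)
    (p : EuclideanSpace ℝ (Fin n)) :
    ∃ x ∈ K, conjOn K f p = inner ℝ p x - f x ∧ IsMaxOn (fun y => inner ℝ p y - f y) K x := by
  obtain ⟨x, hx, h⟩ := hK.exists_sSup_image_eq_and_ge hne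
    (f := fun y => inner ℝ p y - f y) (ContinuousOn.sub (by fun_prop) hf)
  exact ⟨x, hx, h.1, h.2⟩

theorem inner_sub_le_conjOn (hK : IsCompact K) (hf : ContinuousOn f K)
    (p : EuclideanSpace ℝ (Fin n)) (hx : x ∈ K) : inner ℝ p x - f x ≤ conjOn K f p :=
  le_csSup (hK.image_of_continuousOn (ContinuousOn.sub (by fun_prop) hf)).bddAbove
    (mem_image_of_mem _ hx)

theorem conjOn_eq_of_isMaxOn (hK : IsCompact K) (hf : ContinuousOn f K) (hx : x ∈ K)
    (hmax : IsMaxOn (fun y => inner ℝ p y - f y) K x) : conjOn K f p = inner ℝ p x - f x := by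
  obtain ⟨y, hy, h, -⟩ := exists_conjOn_eq hK ⟨x, hx⟩ hf p
  exact le_antisymm (h.trans_le (hmax hy)) (inner_sub_le_conjOn hK hf p hx)

theorem lipschitzWith_conjOn (hK : IsCompact K) (hne : K.Nonempty) (hf : ContinuousOn f K)
    {M : ℝ≥0} (hM : K ⊆ closedBall 0 M) : LipschitzWith M (conjOn K f) := by
  refine LipschitzWith.of_le_add_mul M fun p q => ?_
  obtain ⟨x, hx, h, -⟩ := exists_conjOn_eq hK hne hf p
  have h1 := inner_sub_le_conjOn hK hf q hx
  have h2 : inner ℝ (p - q) x ≤ ‖p - q‖ * ‖x‖ := real_inner_le_norm _ _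
  have h3 : ‖p - q‖ * ‖x‖ ≤ ‖p - q‖ * M :=
    mul_le_mul_of_nonneg_left (mem_closedBall_zero_iff.1 (hM hx)) (norm_nonneg _)
  rw [inner_sub_left] at h2
  rw [dist_eq_norm]
  linarith

theorem continuous_conjOn (hK : IsCompact K) (hne : K.Nonempty) (hf : ContinuousOn f K) :
    Continuous (conjOn K f) := by
  obtain ⟨M, hM⟩ := hK.isBounded.subset_closedBall 0
  exact (lipschitzWith_conjOn hK hne hf (M := M.toNNReal)
    (hM.trans (closedBall_subset_closedBall (Real.le_coe_toNNReal M)))).continuous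

theorem convexOn_conjOn (hK : IsCompact K) (hne : K.Nonempty) (hf : ContinuousOn f K) :
    ConvexOn ℝ univ (conjOn K f) := by
  refine ⟨convex_univ, fun p _ q _ a b ha hb hab => ?_⟩
  obtain ⟨x, hx, h, -⟩ := exists_conjOn_eq hK hne hf (a • p + b • q)
  have h1 := mul_le_mul_of_nonneg_left (inner_sub_le_conjOn hK hf p hx) ha
  have h2 := mul_le_mul_of_nonneg_left (inner_sub_le_conjOn hK hf q hx) hb
  have h3 : f x = a * f x + b * f x := by rw [← add_mul, hab, one_mul]
  rw [h, inner_add_left, real_inner_smul_left, real_inner_smul_left, smul_eq_mul, smul_eq_mul]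
  linarith

theorem conjOn_conjOn_le (hK : IsCompact K) (hf : ContinuousOn f K) (hD : IsCompact D)
    (hDne : D.Nonempty) (hx : x ∈ K) : conjOn D (conjOn K f) x ≤ f x := by
  obtain ⟨p, hp, h, -⟩ := exists_conjOn_eq hD hDne
    (continuous_conjOn hK ⟨x, hx⟩ hf).continuousOn x
  have := inner_sub_le_conjOn hK hf p hx
  rw [h, real_inner_comm]
  linarith

theorem conjOn_conjOn_conjOn_le (hK : IsCompact K) (hne : K.Nonempty) (hf : ContinuousOn f K)
    (hD : IsCompact D) (hp : p ∈ D) : conjOn K (conjOn D (conjOn K f)) p ≤ conjOn K f p := by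
  have hc := (continuous_conjOn hK hne hf).continuousOn (s := D)
  obtain ⟨x, hx, h, -⟩ := exists_conjOn_eq hK hne
    (continuous_conjOn hD ⟨p, hp⟩ hc).continuousOn p
  have := inner_sub_le_conjOn hD hc x hp
  rw [real_inner_comm] at this
  linarith

/-- The double Legendre transform of `f` stays above every minorant that is supported at `x` by a
slope in `D`. -/
theorem le_conjOn_conjOn (hK : IsCompact K) (hf : ContinuousOn f K) (hD : IsCompact D)
    (hgf : ∀ y ∈ K, g y ≤ f y) (hx : x ∈ K) (hp : p ∈ D)
    (hsupp : ∀ y ∈ K, g x + inner ℝ p (y - x) ≤ g y) : g x ≤ conjOn D (conjOn K f) x := by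
  obtain ⟨y, hy, h, -⟩ := exists_conjOn_eq hK ⟨x, hx⟩ hf p
  have h1 := inner_sub_le_conjOn hD (continuous_conjOn hK ⟨x, hx⟩ hf).continuousOn x hp
  have h2 := hsupp y hy
  have h3 := hgf y hy
  rw [inner_sub_right] at h2
  rw [real_inner_comm] at h1
  linarith

/-! ### The gradient of the Legendre transform and the Monge-Ampère measure -/

theorem measurable_gradient_conjOn (K : Set (EuclideanSpace ℝ (Fin n)))
    (f : EuclideanSpace ℝ (Fin n) → ℝ) : Measurable (∇ (conjOn K f)) :=
  (InnerProductSpace.toDual ℝ _).symm.continuous.measurable.comp (measurable_fderiv ℝ _)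

theorem gradient_conjOn_eq_of_isMaxOn (hK : IsCompact K) (hf : ContinuousOn f K)
    (hd : DifferentiableAt ℝ (conjOn K f) p) (hx : x ∈ K)
    (hmax : IsMaxOn (fun y => inner ℝ p y - f y) K x) : ∇ (conjOn K f) p = x := by
  have hmin : IsLocalMin (fun q => conjOn K f q - inner ℝ x q) p := by
    refine Eventually.of_forall fun q => ?_
    have h1 := conjOn_eq_of_isMaxOn hK hf hx hmax
    have h2 := inner_sub_le_conjOn hK hf q hx
    change conjOn K f p - inner ℝ x p ≤ conjOn K f q - inner ℝ x q
    rw [real_inner_comm p x, real_inner_comm q x]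
    linarith
  have h := hmin.hasFDerivAt_eq_zero
    (hd.hasGradientAt.hasFDerivAt.sub (innerSL ℝ x).hasFDerivAt)
  rw [sub_eq_zero] at h
  exact (InnerProductSpace.toDual ℝ _).injective h

/-- For almost every slope `p` the maximizer of `⟨p, ·⟩ - f` over `K` is unique, and equals the
gradient of the Legendre transform. -/
theorem ae_isMaxOn_gradient_conjOn (hK : IsCompact K) (hne : K.Nonempty) (hf : ContinuousOn f K) :
    ∀ᵐ p, ∇ (conjOn K f) p ∈ K ∧
      IsMaxOn (fun y => inner ℝ p y - f y) K (∇ (conjOn K f) p) ∧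
      ∀ x ∈ K, IsMaxOn (fun y => inner ℝ p y - f y) K x → ∇ (conjOn K f) p = x := by
  obtain ⟨M, hM⟩ := hK.isBounded.subset_closedBall 0
  have hL := lipschitzWith_conjOn hK hne hf (M := M.toNNReal)
    (hM.trans (closedBall_subset_closedBall (Real.le_coe_toNNReal M)))
  filter_upwards [hL.ae_differentiableAt] with p hp
  obtain ⟨x, hx, -, hmax⟩ := exists_conjOn_eq hK hne hf p
  have h := gradient_conjOn_eq_of_isMaxOn hK hf hp hx hmax
  exact ⟨h ▸ hx, h ▸ hmax, fun y hy hy' => gradient_conjOn_eq_of_isMaxOn hK hf hp hy hy'⟩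

/-- The Lebesgue measure on the slopes `‖p‖ ≤ L`, transported by the gradient of the Legendre
transform of `f` over `K`. On sets inside `K` it is the Monge-Ampère measure of `f`. -/
noncomputable def slopeMeasure (K : Set (EuclideanSpace ℝ (Fin n))) (L : ℝ≥0)
    (f : EuclideanSpace ℝ (Fin n) → ℝ) : Measure (EuclideanSpace ℝ (Fin n)) :=
  (volume.restrict (closedBall 0 L)).map (∇ (conjOn K f))

instance (L : ℝ≥0) : IsFiniteMeasure (slopeMeasure K L f) := by
  have : IsFiniteMeasure (volume.restrict (closedBall (0 : EuclideanSpace ℝ (Fin n)) L)) :=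
    ⟨by simpa using measure_closedBall_lt_top⟩
  unfold slopeMeasure
  infer_instance

theorem norm_le_of_mem_subgradient {U : Set (EuclideanSpace ℝ (Fin n))} (hU : IsOpen U) {L : ℝ≥0}
    (hf : LipschitzOnWith L f U) (hx : x ∈ U) (hp : p ∈ subgradient U f x) : ‖p‖ ≤ L := by
  have hcont : Tendsto (fun t : ℝ => x + t • p) (𝓝[>] 0) (𝓝 x) := by
    have : Continuous fun t : ℝ => x + t • p := by fun_prop
    simpa using (this.tendsto 0).mono_left nhdsWithin_le_nhds
  obtain ⟨t, htU, ht0⟩ := ((hcont.eventually (hU.mem_nhds hx)).and self_mem_nhdsWithin).exists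
  have ht0 : 0 < t := ht0
  have h1 := hp _ htU
  have h2 := hf.le_add_mul htU hx
  rw [dist_eq_norm] at h2
  simp only [add_sub_cancel_left, inner_smul_right, norm_smul, real_inner_self_eq_norm_sq,
    Real.norm_of_nonneg ht0.le] at h1 h2
  have h3 : t * ‖p‖ ^ 2 ≤ L * (t * ‖p‖) := by linarith
  by_contra! h
  have hp0 : 0 < ‖p‖ := L.2.trans_lt h
  nlinarith [mul_pos ht0 hp0]

theorem mem_subgradient_ball_iff_isMaxOn {x₀ : EuclideanSpace ℝ (Fin n)} {R : ℝ} (hR : 0 < R)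
    (hf : ContinuousOn f (closedBall x₀ R)) :
    p ∈ subgradient (ball x₀ R) f x ↔
      IsMaxOn (fun y => inner ℝ p y - f y) (closedBall x₀ R) x := by
  constructor
  · intro hp
    have hcl : closure (ball x₀ R) = closedBall x₀ R := closure_ball x₀ hR.ne'
    have hle : ∀ y ∈ ball x₀ R, inner ℝ p y - f y ≤ inner ℝ p x - f x := fun y hy => by
      have := hp y hy
      rw [inner_sub_right] at this
      linarith
    intro y hy
    rw [← hcl] at hy hf
    exact ContinuousWithinAt.closure_le hy
      (((ContinuousOn.sub (by fun_prop) hf) y hy).mono subset_closure)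
      continuousWithinAt_const hle
  · intro h y hy
    have : inner ℝ p y - f y ≤ inner ℝ p x - f x := h (ball_subset_closedBall hy)
    rw [inner_sub_right]
    linarith

theorem mongeAmpere_ball_eq_slopeMeasure {x₀ : EuclideanSpace ℝ (Fin n)} {R : ℝ} (hR : 0 < R)
    {L : ℝ≥0} (hf : LipschitzOnWith L f (closedBall x₀ R)) {A : Set (EuclideanSpace ℝ (Fin n))}
    (hA : MeasurableSet A) (hAU : A ⊆ ball x₀ R) :
    mongeAmpere (ball x₀ R) f A = slopeMeasure (closedBall x₀ R) L f A := by
  have hmeas := measurable_gradient_conjOn (closedBall x₀ R) f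
  rw [slopeMeasure, Measure.map_apply hmeas hA, Measure.restrict_apply (hmeas hA), mongeAmpere]
  refine measure_congr ?_
  filter_upwards [ae_isMaxOn_gradient_conjOn (isCompact_closedBall x₀ R)
    ⟨x₀, mem_closedBall_self hR.le⟩ hf.continuousOn] with p hp
  refine propext ⟨fun h => ?_, fun h => ?_⟩
  · obtain ⟨x, hx, hpx⟩ := mem_iUnion₂.1 h
    have h1 := (mem_subgradient_ball_iff_isMaxOn hR hf.continuousOn).1 hpx
    have h2 := hp.2.2 x (ball_subset_closedBall (hAU hx)) h1
    refine ⟨?_, mem_closedBall_zero_iff.2 (norm_le_of_mem_subgradient isOpen_ball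
      (hf.mono ball_subset_closedBall) (hAU hx) hpx)⟩
    rw [mem_preimage, h2]
    exact hx
  · exact mem_iUnion₂.2 ⟨_, h.1,
      (mem_subgradient_ball_iff_isMaxOn hR hf.continuousOn).2 hp.2.1⟩

end Conjugate

/-! ### First variation of the Legendre transform -/

section Variation

open scoped NNReal Gradient

variable {n : ℕ} {K U : Set (EuclideanSpace ℝ (Fin n))} {f g φ η w u : EuclideanSpace ℝ (Fin n) → ℝ}
  {p : EuclideanSpace ℝ (Fin n)} {L : ℝ≥0}

theorem abs_conjOn_sub_conjOn_le (hK : IsCompact K) (hne : K.Nonempty) (hf : ContinuousOn f K)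
    (hg : ContinuousOn g K) {c : ℝ} (hfg : ∀ x ∈ K, |f x - g x| ≤ c)
    (p : EuclideanSpace ℝ (Fin n)) : |conjOn K f p - conjOn K g p| ≤ c := by
  obtain ⟨x, hx, hxf, -⟩ := exists_conjOn_eq hK hne hf p
  obtain ⟨y, hy, hyg, -⟩ := exists_conjOn_eq hK hne hg p
  have h1 := inner_sub_le_conjOn hK hg p hx
  have h2 := inner_sub_le_conjOn hK hf p hy
  have h3 := abs_le.1 (hfg x hx)
  have h4 := abs_le.1 (hfg y hy)
  exact abs_le.2 ⟨by linarith, by linarith⟩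

/-- The maximizers for `f + t η` converge to a unique maximizer for `f`, which therefore determines
the derivative of the Legendre transform in the direction `η`. -/
theorem tendsto_conjOn_variation (hK : IsCompact K) (hf : ContinuousOn f K)
    (hη : Continuous η) {x : EuclideanSpace ℝ (Fin n)} (hx : x ∈ K)
    (hmax : IsMaxOn (fun y => inner ℝ p y - f y) K x)
    (huniq : ∀ y ∈ K, IsMaxOn (fun y => inner ℝ p y - f y) K y → y = x)
    {t : ℕ → ℝ} (ht : ∀ k, 0 < t k) (ht0 : Tendsto t atTop (𝓝 0)) :
    Tendsto (fun k => (conjOn K (fun y => f y + t k * η y) p - conjOn K f p) / t k) atTop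
      (𝓝 (-η x)) := by
  have hft : ∀ k, ContinuousOn (fun y => f y + t k * η y) K := fun k =>
    hf.add (by fun_prop)
  choose y hyK hy _ using fun k => exists_conjOn_eq hK ⟨x, hx⟩ (hft k) p
  have hfx := conjOn_eq_of_isMaxOn hK hf hx hmax
  have hlow : ∀ k, inner ℝ p x - (f x + t k * η x) ≤ conjOn K (fun y => f y + t k * η y) p :=
    fun k => inner_sub_le_conjOn hK (hft k) p hx
  have hup : ∀ k, inner ℝ p (y k) - f (y k) ≤ conjOn K f p := fun k =>
    inner_sub_le_conjOn hK hf p (hyK k)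
  obtain ⟨C, hC⟩ := hK.exists_bound_of_continuousOn hη.continuousOn
  have hlim : Tendsto (fun k => inner ℝ p (y k) - f (y k)) atTop (𝓝 (inner ℝ p x - f x)) := by
    have h1 : Tendsto (fun k => inner ℝ p x - f x - t k * (C + C)) atTop
        (𝓝 (inner ℝ p x - f x)) := by
      simpa using (ht0.mul_const (C + C)).const_sub (inner ℝ p x - f x)
    refine tendsto_of_tendsto_of_tendsto_of_le_of_le h1 tendsto_const_nhds (fun k => ?_) fun k => ?_
    · have h2 := (abs_le.1 (hC x hx)).2
      have h3 := (abs_le.1 (hC (y k) (hyK k))).1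
      have h4 := hlow k
      rw [hy k] at h4
      have h5 : t k * (η x - η (y k)) ≤ t k * (C + C) :=
        mul_le_mul_of_nonneg_left (by linarith) (ht k).le
      dsimp only
      linarith
    · exact (hup k).trans_eq hfx
  have hylim : Tendsto y atTop (𝓝 x) := by
    refine hK.tendsto_nhds_of_unique_mapClusterPt (Eventually.of_forall hyK) fun z hz hcl => ?_
    obtain ⟨ψ, hψ, hψz⟩ := hcl.tendsto_subseq
    have hcont : ContinuousOn (fun y => inner ℝ p y - f y) K := ContinuousOn.sub (by fun_prop) hf
    have h1 : Tendsto (fun k => inner ℝ p (y (ψ k)) - f (y (ψ k))) atTop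
        (𝓝 (inner ℝ p z - f z)) :=
      (hcont z hz).tendsto.comp (tendsto_nhdsWithin_iff.2
        ⟨hψz, Eventually.of_forall fun k => hyK (ψ k)⟩)
    have h2 := tendsto_nhds_unique h1 (hlim.comp hψ.tendsto_atTop)
    refine huniq z hz fun v hv => ?_
    have h3 : inner ℝ p v - f v ≤ inner ℝ p x - f x := hmax hv
    exact h3.trans_eq h2.symm
  refine tendsto_of_tendsto_of_tendsto_of_le_of_le tendsto_const_nhds
    ((hη.tendsto x).comp hylim).neg (fun k => ?_) fun k => ?_
  · rw [le_div_iff₀ (ht k)]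
    linarith [hlow k]
  · rw [Function.comp_apply, div_le_iff₀ (ht k)]
    have := hup k
    have := hy k
    linarith

theorem tendsto_setIntegral_conjOn_variation (hK : IsCompact K) (hne : K.Nonempty)
    (hf : ContinuousOn f K) (hη : Continuous η) {t : ℕ → ℝ} (ht : ∀ k, 0 < t k)
    (ht0 : Tendsto t atTop (𝓝 0)) :
    Tendsto (fun k => ∫ p in closedBall 0 L,
        (conjOn K (fun y => f y + t k * η y) p - conjOn K f p) / t k) atTop
      (𝓝 (-∫ x, η x ∂slopeMeasure K L f)) := by
  have hmeas := measurable_gradient_conjOn K f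
  rw [slopeMeasure, integral_map hmeas.aemeasurable hη.aestronglyMeasurable, ← integral_neg]
  obtain ⟨C, hC⟩ := hK.exists_bound_of_continuousOn hη.continuousOn
  have hft : ∀ k, ContinuousOn (fun y => f y + t k * η y) K := fun k => hf.add (by fun_prop)
  have hfin : volume (closedBall (0 : EuclideanSpace ℝ (Fin n)) L) ≠ ⊤ :=
    measure_closedBall_lt_top.ne
  refine tendsto_integral_of_dominated_convergence (fun _ => C) (fun k => ?_)
    (integrableOn_const hfin) (fun k => Eventually.of_forall fun p => ?_) ?_
  · exact (((continuous_conjOn hK hne (hft k)).sub (continuous_conjOn hK hne hf)).div_const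
      _).aestronglyMeasurable
  · rw [norm_div, Real.norm_of_nonneg (ht k).le, div_le_iff₀ (ht k), mul_comm C]
    refine abs_conjOn_sub_conjOn_le hK hne (hft k) hf (fun x hx => ?_) p
    rw [add_sub_cancel_left, abs_mul, abs_of_pos (ht k)]
    exact mul_le_mul_of_nonneg_left (hC x hx) (ht k).le
  · filter_upwards [ae_restrict_of_ae (ae_isMaxOn_gradient_conjOn hK hne hf)] with p hp
    exact tendsto_conjOn_variation hK hf hη hp.1 hp.2.1
      (fun y hy hy' => (hp.2.2 y hy hy').symm) ht ht0

/-! ### A variational problem between two obstacles -/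

/-- The competitors: `L`-Lipschitz functions on `K` between the obstacles `w` and `u` that agree
with `w` on the boundary part `K \ U`. -/
def competitors (K U : Set (EuclideanSpace ℝ (Fin n))) (L : ℝ≥0)
    (w u : EuclideanSpace ℝ (Fin n) → ℝ) : Set (EuclideanSpace ℝ (Fin n) → ℝ) :=
  {f | LipschitzOnWith L f K ∧ ∀ x ∈ K, w x ≤ f x ∧ f x ≤ u x ∧ (x ∉ U → f x = w x)}

/-- The functional `∫_U f dμ + ∫_{‖p‖ ≤ L} f*(p) dp`, with `f*` the Legendre transform over `K`; its
Euler-Lagrange equation is `ℳ f = μ` in `U`. -/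
noncomputable def energy (K U : Set (EuclideanSpace ℝ (Fin n))) (L : ℝ≥0)
    (μ : Measure (EuclideanSpace ℝ (Fin n))) (f : EuclideanSpace ℝ (Fin n) → ℝ) : ℝ :=
  ∫ x in U, f x ∂μ + ∫ p in closedBall 0 L, conjOn K f p

variable {μ : Measure (EuclideanSpace ℝ (Fin n))} [IsFiniteMeasure μ]

theorem integrableOn_conjOn (hK : IsCompact K) (hne : K.Nonempty) (hf : ContinuousOn f K) :
    IntegrableOn (conjOn K f) (closedBall 0 L) :=
  (continuous_conjOn hK hne hf).continuousOn.integrableOn_compact (isCompact_closedBall _ _)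

theorem abs_energy_sub_le (hK : IsCompact K) (hne : K.Nonempty) (hUK : U ⊆ K)
    (hf : ContinuousOn f K) (hg : ContinuousOn g K) {c : ℝ}
    (hfg : ∀ x ∈ K, |f x - g x| ≤ c) :
    |energy K U L μ f - energy K U L μ g| ≤
      c * (μ.real U + volume.real (closedBall (0 : EuclideanSpace ℝ (Fin n)) L)) := by
  have h1 : ‖∫ x in U, (f x - g x) ∂μ‖ ≤ c * μ.real U :=
    norm_setIntegral_le_of_norm_le_const (measure_lt_top _ _) fun x hx => hfg x (hUK hx)
  have h2 : ‖∫ p in closedBall 0 L, (conjOn K f p - conjOn K g p)‖ ≤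
      c * volume.real (closedBall (0 : EuclideanSpace ℝ (Fin n)) L) :=
    norm_setIntegral_le_of_norm_le_const measure_closedBall_lt_top fun p _ =>
      abs_conjOn_sub_conjOn_le hK hne hf hg hfg p
  rw [integral_sub ((hf.integrableOn_compact hK).mono_set hUK)
    ((hg.integrableOn_compact hK).mono_set hUK), Real.norm_eq_abs] at h1
  rw [integral_sub (integrableOn_conjOn hK hne hf) (integrableOn_conjOn hK hne hg),
    Real.norm_eq_abs] at h2
  have h3 := abs_add_le (∫ x in U, f x ∂μ - ∫ x in U, g x ∂μ)
    ((∫ p in closedBall 0 L, conjOn K f p) - ∫ p in closedBall 0 L, conjOn K g p)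
  rw [energy, energy, add_sub_add_comm, mul_add]
  linarith

/-- The energy attains its minimum: by Arzelà-Ascoli the competitors, seen as elements of `C(K, ℝ)`,
form a compact set, on which the energy is Lipschitz. -/
theorem exists_energy_le (hK : IsCompact K) (hne : K.Nonempty) (hUK : U ⊆ K)
    (hw : w ∈ competitors K U L w u) :
    ∃ φ ∈ competitors K U L w u, ∀ f ∈ competitors K U L w u,
      energy K U L μ φ ≤ energy K U L μ f := by
  have : CompactSpace K := isCompact_iff_compactSpace.1 hK
  let P : (K → ℝ) → Prop := fun h => LipschitzWith L h ∧
    ∀ x : K, w x ≤ h x ∧ h x ≤ u x ∧ ((x : EuclideanSpace ℝ (Fin n)) ∉ U → h x = w x)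
  let S : Set C(K, ℝ) := {h | P h}
  have hPclosed : IsClosed {h : K → ℝ | P h} := by
    have : {h : K → ℝ | P h} = (⋂ x, ⋂ y, {h | dist (h x) (h y) ≤ L * dist x y}) ∩
        ⋂ x : K, ({h | w x ≤ h x} ∩ ({h | h x ≤ u x} ∩
          {h | (x : EuclideanSpace ℝ (Fin n)) ∉ U → h x = w x})) := by
      ext h
      simp [P, lipschitzWith_iff_dist_le_mul]
    rw [this]
    refine (isClosed_iInter fun x => isClosed_iInter fun y =>
      isClosed_le (by fun_prop) continuous_const).inter (isClosed_iInter fun x => ?_)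
    refine (isClosed_le continuous_const (by fun_prop)).inter
      ((isClosed_le (by fun_prop) continuous_const).inter ?_)
    by_cases hx : (x : EuclideanSpace ℝ (Fin n)) ∈ U
    · simp [hx]
    · simpa [hx] using isClosed_eq (continuous_apply x) continuous_const
  have hScompact : IsCompact S := by
    refine ArzelaAscoli.isCompact_of_equicontinuous S ?_
      (LipschitzWith.uniformEquicontinuous _ L fun h => h.2.1).equicontinuous
    have himage : ContinuousMap.toFun '' S = {h : K → ℝ | P h} := by
      ext h
      constructor
      · rintro ⟨h, hh, rfl⟩
        exact hh
      · intro hh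
        exact ⟨⟨h, hh.1.continuous⟩, hh, rfl⟩
    rw [himage]
    refine (isCompact_univ_pi fun x : K => isCompact_Icc (a := w x) (b := u x)).of_isClosed_subset
      hPclosed fun h hh x _ => ⟨(hh.2 x).1, (hh.2 x).2.1⟩
  let ext : C(K, ℝ) → EuclideanSpace ℝ (Fin n) → ℝ := fun h => Function.extend Subtype.val h 0
  have hext : ∀ (h : C(K, ℝ)) (x : K), ext h x = h x := fun h x =>
    Subtype.val_injective.extend_apply h 0 x
  have hextc : ∀ h : C(K, ℝ), ContinuousOn (ext h) K := fun h => by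
    rw [continuousOn_iff_continuous_domRestrict]
    convert h.continuous using 1
    exact funext fun x => hext h x
  have hEcont : Continuous fun h => energy K U L μ (ext h) := by
    set c := μ.real U + volume.real (closedBall (0 : EuclideanSpace ℝ (Fin n)) L) with hc
    have hc0 : 0 ≤ c := by positivity
    refine (LipschitzWith.of_dist_le_mul (K := ⟨c, hc0⟩) fun h h' => ?_).continuous
    rw [Real.dist_eq, mul_comm]
    refine abs_energy_sub_le hK hne hUK (hextc h) (hextc h') fun x hx => ?_
    rw [hext h ⟨x, hx⟩, hext h' ⟨x, hx⟩, ← Real.dist_eq]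
    exact ContinuousMap.dist_apply_le_dist _
  have hmemS : ∀ f ∈ competitors K U L w u, ∃ h ∈ S, ∀ x : K, h x = f x := fun f hf =>
    ⟨⟨K.domRestrict f, hf.1.continuousOn.domRestrict⟩, ⟨hf.1.to_restrict, fun x => hf.2 x x.2⟩,
      fun x => rfl⟩
  obtain ⟨h₀, hh₀, -⟩ := hmemS w hw
  obtain ⟨h, hh, hmin⟩ := hScompact.exists_isMinOn ⟨h₀, hh₀⟩ hEcont.continuousOn
  refine ⟨ext h, ⟨?_, fun x hx => ?_⟩, fun f hf => ?_⟩
  · refine LipschitzOnWith.of_dist_le_mul fun x hx y hy => ?_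
    rw [hext h ⟨x, hx⟩, hext h ⟨y, hy⟩]
    exact hh.1.dist_le_mul ⟨x, hx⟩ ⟨y, hy⟩
  · rw [hext h ⟨x, hx⟩]
    exact hh.2 ⟨x, hx⟩
  · obtain ⟨h', hh', hf'⟩ := hmemS f hf
    have h1 : energy K U L μ (ext h) ≤ energy K U L μ (ext h') := hmin hh'
    have h2 := abs_energy_sub_le (L := L) (μ := μ) (c := 0) hK hne hUK (hextc h')
      hf.1.continuousOn fun x hx => by rw [hext h' ⟨x, hx⟩, hf' ⟨x, hx⟩, sub_self, abs_zero]
    rw [zero_mul, abs_nonpos_iff, sub_eq_zero] at h2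
    exact h1.trans_eq h2

/-- Passing to the double Legendre transform turns a function between the obstacles into a convex
competitor without increasing the energy. -/
theorem conjOn_conjOn_mem_competitors (hK : IsCompact K) (hne : K.Nonempty)
    (hU : MeasurableSet U) (hUK : U ⊆ K) (hf : ContinuousOn f K)
    (hwsupp : ∀ x ∈ K, ∃ p ∈ closedBall 0 (L : ℝ), ∀ y ∈ K, w x + inner ℝ p (y - x) ≤ w y)
    (hwf : ∀ x ∈ K, w x ≤ f x ∧ f x ≤ u x ∧ (x ∉ U → f x = w x)) :
    conjOn (closedBall 0 L) (conjOn K f) ∈ competitors K U L w u ∧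
      energy K U L μ (conjOn (closedBall 0 L) (conjOn K f)) ≤ energy K U L μ f := by
  have hD : IsCompact (closedBall (0 : EuclideanSpace ℝ (Fin n)) L) := isCompact_closedBall _ _
  have hDne : (closedBall (0 : EuclideanSpace ℝ (Fin n)) L).Nonempty :=
    ⟨0, mem_closedBall_self L.2⟩
  have hlip := lipschitzWith_conjOn hD hDne (continuous_conjOn hK hne hf).continuousOn
    Subset.rfl
  have hlow : ∀ x ∈ K, w x ≤ conjOn (closedBall 0 L) (conjOn K f) x := fun x hx => by
    obtain ⟨p, hp, hsupp⟩ := hwsupp x hx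
    exact le_conjOn_conjOn hK hf hD (fun y hy => (hwf y hy).1) hx hp hsupp
  have hup : ∀ x ∈ K, conjOn (closedBall 0 L) (conjOn K f) x ≤ f x := fun x hx =>
    conjOn_conjOn_le hK hf hD hDne hx
  refine ⟨⟨hlip.lipschitzOnWith, fun x hx => ⟨hlow x hx, (hup x hx).trans (hwf x hx).2.1,
    fun hxU => le_antisymm ((hup x hx).trans_eq ((hwf x hx).2.2 hxU)) (hlow x hx)⟩⟩, ?_⟩
  refine add_le_add ?_ ?_
  · exact setIntegral_mono_on ((hlip.continuous.continuousOn.integrableOn_compact hK).mono_set hUK)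
      ((hf.integrableOn_compact hK).mono_set hUK) hU fun x hx => hup x (hUK hx)
  · exact setIntegral_mono_on (integrableOn_conjOn hK hne hlip.continuous.continuousOn)
      (integrableOn_conjOn hK hne hf) measurableSet_closedBall fun p hp =>
        conjOn_conjOn_conjOn_le hK hne hf hD hp

/-- The first variation inequality for a minimizer, in the directions that respect the obstacles. -/
theorem integral_slopeMeasure_le_of_energy_le (hK : IsCompact K) (hne : K.Nonempty)
    (hU : MeasurableSet U) (hUK : U ⊆ K)
    (hwsupp : ∀ x ∈ K, ∃ p ∈ closedBall 0 (L : ℝ), ∀ y ∈ K, w x + inner ℝ p (y - x) ≤ w y)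
    (hφ : φ ∈ competitors K U L w u)
    (hmin : ∀ f ∈ competitors K U L w u, energy K U L μ φ ≤ energy K U L μ f)
    (hη : Continuous η) (hηU : ∀ x ∉ U, η x = 0) {t₀ : ℝ} (ht₀ : 0 < t₀)
    (hobst : ∀ t, 0 < t → t ≤ t₀ → ∀ x ∈ K, w x ≤ φ x + t * η x ∧ φ x + t * η x ≤ u x) :
    ∫ x, η x ∂slopeMeasure K L φ ≤ ∫ x in U, η x ∂μ := by
  have hφc := hφ.1.continuousOn
  let t : ℕ → ℝ := fun k => t₀ / (k + 1)
  have ht : ∀ k, 0 < t k := fun k => by positivity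
  have htt₀ : ∀ k, t k ≤ t₀ := fun k => div_le_self ht₀.le (by
    have : (0 : ℝ) ≤ k := k.cast_nonneg
    linarith)
  have ht0 : Tendsto t atTop (𝓝 0) := by
    have := (tendsto_one_div_add_atTop_nhds_zero_nat (𝕜 := ℝ)).const_mul t₀
    simpa [t, div_eq_mul_inv] using this
  have hlim := tendsto_setIntegral_conjOn_variation (L := L) hK hne hφc hη ht ht0
  refine neg_le_neg_iff.1 (ge_of_tendsto' hlim fun k => ?_)
  have hft : ContinuousOn (fun y => φ y + t k * η y) K := hφc.add (by fun_prop)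
  obtain ⟨hmem, hle⟩ := conjOn_conjOn_mem_competitors (μ := μ) hK hne hU hUK hft hwsupp
    (u := u) fun x hx => ⟨(hobst _ (ht k) (htt₀ k) x hx).1, (hobst _ (ht k) (htt₀ k) x hx).2,
      fun hxU => by rw [hηU x hxU, mul_zero, add_zero, (hφ.2 x hx).2.2 hxU]⟩
  have h := (hmin _ hmem).trans hle
  have hηint : IntegrableOn (fun x => t k * η x) U μ :=
    ((by fun_prop : ContinuousOn (fun x => t k * η x) K).integrableOn_compact hK).mono_set hUK
  rw [energy, energy, integral_add ((hφc.integrableOn_compact hK).mono_set hUK) hηint,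
    integral_const_mul] at h
  rw [integral_div, integral_sub (integrableOn_conjOn hK hne hft) (integrableOn_conjOn hK hne hφc),
    le_div_iff₀ (ht k)]
  linarith

end Variation

/-! ### Solving the Monge-Ampère equation between a subsolution and a solution -/

section Existence

open scoped NNReal Gradient

theorem measure_le_of_forall_integral_le {X : Type*} [TopologicalSpace X] [R1Space X]
    [LocallyCompactSpace X] [MeasurableSpace X] [BorelSpace X]
    {ν μ : Measure X} [IsFiniteMeasure ν] [IsFiniteMeasure μ] [ν.InnerRegularCompactLTTop]
    [μ.OuterRegular] {V A : Set X} (hV : IsOpen V) (hA : MeasurableSet A) (hAV : A ⊆ V)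
    (h : ∀ (η : X → ℝ) (F : Set X), Continuous η → IsCompact F → F ⊆ V → (∀ x ∉ F, η x = 0) →
      (∀ x, 0 ≤ η x ∧ η x ≤ 1) → ∫ x, η x ∂ν ≤ ∫ x, η x ∂μ) : ν A ≤ μ A := by
  rw [hA.measure_eq_iSup_isCompact_of_ne_top (measure_ne_top ν A)]
  refine iSup₂_le fun F hFA => iSup_le fun hF => ?_
  refine le_trans ?_ (measure_mono hFA)
  rw [F.measure_eq_iInf_isOpen μ]
  refine le_iInf₂ fun O hFO => le_iInf fun hO => ?_
  obtain ⟨F', hF', hFF', hF'OV⟩ := exists_compact_between hF (hO.inter hV)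
    (subset_inter hFO (hFA.trans hAV))
  obtain ⟨η, hη1, hη0, -, hη⟩ := exists_continuous_one_zero_of_isCompact hF
    (isOpen_interior (s := F')).isClosed_compl (disjoint_compl_right_iff_subset.2 hFF')
  have hη0' : ∀ x ∉ F', η x = 0 := fun x hx => hη0 fun h => hx (interior_subset h)
  have hint := h η F' η.continuous hF' (hF'OV.trans inter_subset_right) hη0' hη
  have hintegrable : ∀ (m : Measure X) [IsFiniteMeasure m], Integrable η m := fun m _ =>
    Integrable.of_bound η.continuous.measurable.aestronglyMeasurable 1
      (Eventually.of_forall fun x => by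
        rw [Real.norm_of_nonneg (hη x).1]
        exact (hη x).2)
  calc ν F = ∫⁻ x in F, 1 ∂ν := setLIntegral_one F |>.symm
    _ ≤ ∫⁻ x in F, ENNReal.ofReal (η x) ∂ν := setLIntegral_mono (by fun_prop) fun x hx => by
        simp [hη1 hx]
    _ ≤ ∫⁻ x, ENNReal.ofReal (η x) ∂ν := setLIntegral_le_lintegral _ _
    _ = ENNReal.ofReal (∫ x, η x ∂ν) := (ofReal_integral_eq_lintegral_ofReal (hintegrable ν)
        (Eventually.of_forall fun x => (hη x).1)).symm
    _ ≤ ENNReal.ofReal (∫ x, η x ∂μ) := ENNReal.ofReal_le_ofReal hint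
    _ = ∫⁻ x, ENNReal.ofReal (η x) ∂μ := ofReal_integral_eq_lintegral_ofReal (hintegrable μ)
        (Eventually.of_forall fun x => (hη x).1)
    _ ≤ ∫⁻ x, O.indicator 1 x ∂μ := lintegral_mono fun x => by
        by_cases hx : x ∈ O
        · simpa [hx] using (hη x).2
        · simp [hη0' x fun h => hx (hF'OV h).1]
    _ = μ O := by rw [lintegral_indicator_one hO.measurableSet]

variable {n : ℕ} {U : Set (EuclideanSpace ℝ (Fin n))} {f g w u : EuclideanSpace ℝ (Fin n) → ℝ}
  {L : ℝ≥0}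

theorem mongeAmpere_mono_of_eqOn {A : Set (EuclideanSpace ℝ (Fin n))}
    (hfg : ∀ x ∈ U, f x ≤ g x) (hA : ∀ x ∈ A, f x = g x) :
    mongeAmpere U f A ≤ mongeAmpere U g A :=
  measure_mono <| iUnion₂_mono fun x hx p hp y hy =>
    (hA x hx ▸ hp y hy : g x + inner ℝ p (y - x) ≤ f y).trans (hfg y hy)

/-- Between a subsolution `w` and a solution `u` lies a solution with the boundary values of `w`,
for the right-hand side given by `u`. -/
theorem exists_mongeAmpere_eq_between {x₀ : EuclideanSpace ℝ (Fin n)} {R : ℝ} (hR : 0 < R)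
    (hu : LipschitzOnWith L u (closedBall x₀ R)) (hw : LipschitzOnWith L w (closedBall x₀ R))
    (hwsupp : ∀ x ∈ closedBall x₀ R, ∃ p ∈ closedBall 0 (L : ℝ), ∀ y ∈ closedBall x₀ R,
      w x + inner ℝ p (y - x) ≤ w y)
    (hwu : ∀ x ∈ closedBall x₀ R, w x ≤ u x)
    (hMA : ∀ A, MeasurableSet A → A ⊆ ball x₀ R →
      mongeAmpere (ball x₀ R) u A ≤ mongeAmpere (ball x₀ R) w A) :
    ∃ φ : EuclideanSpace ℝ (Fin n) → ℝ, Continuous φ ∧ ConvexOn ℝ univ φ ∧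
      (∀ x ∈ closedBall x₀ R, w x ≤ φ x ∧ φ x ≤ u x) ∧ (∀ x ∈ sphere x₀ R, φ x = w x) ∧
      ∀ A, MeasurableSet A → A ⊆ ball x₀ R →
        mongeAmpere (ball x₀ R) φ A = mongeAmpere (ball x₀ R) u A := by
  set K := closedBall x₀ R with hKdef
  set U := ball x₀ R with hUdef
  have hK : IsCompact K := isCompact_closedBall x₀ R
  have hne : K.Nonempty := ⟨x₀, mem_closedBall_self hR.le⟩
  have hUK : U ⊆ K := ball_subset_closedBall
  have hUm : MeasurableSet U := measurableSet_ball
  let μ := slopeMeasure K L u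
  obtain ⟨φ₀, hφ₀, hmin₀⟩ := exists_energy_le (μ := μ) (U := U) (w := w) (u := u) hK hne hUK
    ⟨hw, fun x hx => ⟨le_rfl, hwu x hx, fun _ => rfl⟩⟩
  obtain ⟨hφ, hφle⟩ := conjOn_conjOn_mem_competitors (μ := μ) hK hne hUm hUK
    hφ₀.1.continuousOn hwsupp hφ₀.2
  have hconjc := continuous_conjOn hK hne hφ₀.1.continuousOn
  have hDne : (closedBall (0 : EuclideanSpace ℝ (Fin n)) L).Nonempty :=
    ⟨0, mem_closedBall_self L.2⟩
  have hφcont := continuous_conjOn (isCompact_closedBall _ _) hDne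
    (hconjc.continuousOn (s := closedBall 0 (L : ℝ)))
  have hφconv := convexOn_conjOn (isCompact_closedBall _ _) hDne
    (hconjc.continuousOn (s := closedBall 0 (L : ℝ)))
  set φ := conjOn (closedBall 0 L) (conjOn K φ₀) with hφdef
  have hmin : ∀ f ∈ competitors K U L w u, energy K U L μ φ ≤ energy K U L μ f := fun f hf =>
    hφle.trans (hmin₀ f hf)
  have hint : ∀ (η : EuclideanSpace ℝ (Fin n) → ℝ) (F : Set (EuclideanSpace ℝ (Fin n))), F ⊆ U →
      (∀ x ∉ F, η x = 0) → ∫ x in U, η x ∂μ = ∫ x, η x ∂μ := fun η F hF hη =>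
    setIntegral_eq_integral_of_forall_compl_eq_zero fun x hx => hη x fun h => hx (hF h)
  have hopen : ∀ {f g : EuclideanSpace ℝ (Fin n) → ℝ}, ContinuousOn f K → ContinuousOn g K →
      IsOpen (U ∩ {x | 0 < g x - f x}) := fun hf hg =>
    ((hg.mono hUK).sub (hf.mono hUK)).isOpen_inter_preimage isOpen_ball isOpen_Ioi
  -- above the lower obstacle and below the upper one, both signs of the variation are available
  have hle : ∀ A, MeasurableSet A → A ⊆ U ∩ {x | 0 < u x - φ x} →
      slopeMeasure K L φ A ≤ slopeMeasure K L u A := by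
    intro A hA hAV
    refine measure_le_of_forall_integral_le (hopen hφcont.continuousOn hu.continuousOn) hA hAV
      fun η F hη hF hFV hηF hη01 => ?_
    obtain ⟨t₀, ht₀, ht₀F⟩ := exists_pos_mul_lt_of_isCompact hF (g := fun _ => 1)
      ((hu.continuousOn.sub hφcont.continuousOn).mono ((hFV.trans inter_subset_left).trans hUK))
      continuousOn_const fun x hx => (hFV hx).2
    rw [← hint η F (hFV.trans inter_subset_left) hηF]
    refine integral_slopeMeasure_le_of_energy_le hK hne hUm hUK hwsupp hφ hmin hη
      (fun x hx => hηF x fun h => hx (hFV h).1) ht₀ fun t ht htt₀ x hx => ?_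
    have h1 := hφ.2 x hx
    have h2 := mul_nonneg ht.le (hη01 x).1
    refine ⟨by linarith, ?_⟩
    by_cases hxF : x ∈ F
    · have h3 := ht₀F x hxF
      have h4 : t * η x ≤ t₀ * 1 := mul_le_mul htt₀ (hη01 x).2 (hη01 x).1 ht₀.le
      simp only [Pi.sub_apply] at h3
      linarith
    · rw [hηF x hxF]
      linarith
  have hge : ∀ A, MeasurableSet A → A ⊆ U ∩ {x | 0 < φ x - w x} →
      slopeMeasure K L u A ≤ slopeMeasure K L φ A := by
    intro A hA hAV
    refine measure_le_of_forall_integral_le (hopen hw.continuousOn hφcont.continuousOn) hA hAV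
      fun η F hη hF hFV hηF hη01 => ?_
    obtain ⟨t₀, ht₀, ht₀F⟩ := exists_pos_mul_lt_of_isCompact hF (g := fun _ => 1)
      ((hφcont.continuousOn.sub hw.continuousOn).mono ((hFV.trans inter_subset_left).trans hUK))
      continuousOn_const fun x hx => (hFV hx).2
    have hηF' : ∀ x ∉ F, -η x = 0 := fun x hx => by rw [hηF x hx, neg_zero]
    have := integral_slopeMeasure_le_of_energy_le (η := fun x => -η x) hK hne hUm hUK
      hwsupp hφ hmin hη.neg
      (fun x hx => hηF' x fun h => hx (hFV h).1) ht₀ fun t ht htt₀ x hx => ?_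
    · rw [hint _ F (hFV.trans inter_subset_left) hηF', integral_neg, integral_neg] at this
      exact neg_le_neg_iff.1 this
    have h1 := hφ.2 x hx
    have h2 := mul_nonneg ht.le (hη01 x).1
    rw [mul_neg]
    refine ⟨?_, by linarith⟩
    by_cases hxF : x ∈ F
    · have h3 := ht₀F x hxF
      have h4 : t * η x ≤ t₀ * 1 := mul_le_mul htt₀ (hη01 x).2 (hη01 x).1 ht₀.le
      simp only [Pi.sub_apply] at h3
      linarith
    · rw [hηF x hxF]
      linarith
  refine ⟨φ, hφcont, hφconv, fun x hx => ⟨(hφ.2 x hx).1, (hφ.2 x hx).2.1⟩, fun x hx =>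
    (hφ.2 x (sphere_subset_closedBall hx)).2.2 fun h => (mem_ball.1 h).ne hx, fun A hA hAU => ?_⟩
  have hν : ∀ B, MeasurableSet B → B ⊆ U → mongeAmpere U φ B = slopeMeasure K L φ B :=
    fun B hB hBU => mongeAmpere_ball_eq_slopeMeasure hR hφ.1 hB hBU
  have hμ : ∀ B, MeasurableSet B → B ⊆ U → mongeAmpere U u B = slopeMeasure K L u B :=
    fun B hB hBU => mongeAmpere_ball_eq_slopeMeasure hR hu hB hBU
  rw [hν A hA hAU, hμ A hA hAU]
  refine le_antisymm ?_ ?_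
  · have hV := (hopen hφcont.continuousOn hu.continuousOn).measurableSet
    have hsub : A \ (U ∩ {x | 0 < u x - φ x}) ⊆ U := sdiff_subset.trans hAU
    rw [← measure_inter_add_sdiff A hV, ← measure_inter_add_sdiff (μ := slopeMeasure K L u) A hV]
    refine add_le_add (hle _ (hA.inter hV) inter_subset_right) ?_
    rw [← hν _ (hA.diff hV) hsub, ← hμ _ (hA.diff hV) hsub]
    refine mongeAmpere_mono_of_eqOn (fun x hx => (hφ.2 x (hUK hx)).2.1) fun x hx => ?_
    have h1 : ¬ 0 < u x - φ x := fun h => hx.2 ⟨hAU hx.1, h⟩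
    have h2 := (hφ.2 x (hUK (hAU hx.1))).2.1
    linarith
  · have hV := (hopen hw.continuousOn hφcont.continuousOn).measurableSet
    have hsub : A \ (U ∩ {x | 0 < φ x - w x}) ⊆ U := sdiff_subset.trans hAU
    rw [← measure_inter_add_sdiff A hV, ← measure_inter_add_sdiff (μ := slopeMeasure K L φ) A hV]
    refine add_le_add (hge _ (hA.inter hV) inter_subset_right) ?_
    rw [← hν _ (hA.diff hV) hsub, ← hμ _ (hA.diff hV) hsub]
    refine (hMA _ (hA.diff hV) hsub).trans
      (mongeAmpere_mono_of_eqOn (fun x hx => (hφ.2 x (hUK hx)).1) fun x hx => ?_)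
    have h1 : ¬ 0 < φ x - w x := fun h => hx.2 ⟨hAU hx.1, h⟩
    have h2 := (hφ.2 x (hUK (hAU hx.1))).1
    linarith

end Existence

/-! ### Anisotropic rescaling along a segment -/

section Rescaling

open scoped NNReal Pointwise

variable {n : ℕ} {Ω : Set (EuclideanSpace ℝ (Fin n))} {u : EuclideanSpace ℝ (Fin n) → ℝ}
  {lam Lam : ℝ} {p x₀ e x : EuclideanSpace ℝ (Fin n)} {β : ℝ}

/-- The linear map `v ↦ (v + β ⟨e, v⟩ e) / 2`: it halves lengths orthogonally to the unit vector `e`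
and stretches them along `e` when `β` is large. -/
noncomputable def stretch (e : EuclideanSpace ℝ (Fin n)) (β : ℝ) :
    EuclideanSpace ℝ (Fin n) →ₗ[ℝ] EuclideanSpace ℝ (Fin n) :=
  (1 / 2 : ℝ) • LinearMap.transvection (innerSL ℝ (β • e)).toLinearMap e

theorem stretch_apply (e : EuclideanSpace ℝ (Fin n)) (β : ℝ) (v : EuclideanSpace ℝ (Fin n)) :
    stretch e β v = (1 / 2 : ℝ) • (v + (β * inner ℝ e v) • e) := by
  simp [stretch, LinearMap.transvection.apply]

theorem inner_stretch_right (q v : EuclideanSpace ℝ (Fin n)) :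
    inner ℝ q (stretch e β v) = inner ℝ (stretch e β q) v := by
  simp only [stretch_apply, inner_smul_right, inner_add_right, real_inner_smul_left,
    inner_add_left, real_inner_comm e q]
  ring

theorem det_stretch (he : ‖e‖ = 1) : LinearMap.det (stretch e β) = (1 / 2) ^ n * (1 + β) := by
  rw [stretch, LinearMap.det_smul, finrank_euclideanSpace_fin, LinearMap.transvection.det]
  simp [he]

/-- The function `u - ℓ` precomposed with the stretching map centred at `x₀`, plus `ℓ`, where `ℓ`
is the affine function of slope `p` that agrees with `u` at `x₀`. -/
noncomputable def rescaled (u : EuclideanSpace ℝ (Fin n) → ℝ) (p x₀ e : EuclideanSpace ℝ (Fin n))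
    (β : ℝ) (x : EuclideanSpace ℝ (Fin n)) : ℝ :=
  u (x₀ + stretch e β (x - x₀)) + inner ℝ p (x - x₀ - stretch e β (x - x₀))

theorem rescaled_self : rescaled u p x₀ e β x₀ = u x₀ := by simp [rescaled]

theorem add_stretch_eq (x : EuclideanSpace ℝ (Fin n)) : x₀ + stretch e β (x - x₀) =
    (1 / 2 : ℝ) • x + (1 / 2 : ℝ) • (x₀ + (β * inner ℝ e (x - x₀)) • e) := by
  rw [stretch_apply]
  module

theorem abs_mul_inner_le (he : ‖e‖ = 1) (hβ : 0 ≤ β) {r ρ : ℝ} (hr : β * r ≤ ρ)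
    (hx : x ∈ ball x₀ r) : |β * inner ℝ e (x - x₀)| ≤ ρ := by
  have h1 : |inner ℝ e (x - x₀)| ≤ ‖e‖ * ‖x - x₀‖ := abs_real_inner_le_norm _ _
  rw [he, one_mul, ← dist_eq_norm] at h1
  rw [abs_mul, abs_of_nonneg hβ]
  exact (mul_le_mul_of_nonneg_left (h1.trans (mem_ball.1 hx).le) hβ).trans hr

theorem ConvexOn.add_stretch_mem (hu : ConvexOn ℝ Ω u) (he : ‖e‖ = 1) (hβ : 0 ≤ β) {r ρ : ℝ}
    (hr : β * r ≤ ρ) (hrΩ : ball x₀ r ⊆ Ω)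
    (hseg : ∀ t : ℝ, |t| ≤ ρ → x₀ + t • e ∈ contactSet Ω u p x₀) (hx : x ∈ ball x₀ r) :
    x₀ + stretch e β (x - x₀) ∈ Ω := by
  rw [add_stretch_eq]
  exact hu.1 (hrΩ hx) (hseg _ (abs_mul_inner_le he hβ hr hx)).1 (by norm_num) (by norm_num)
    (by norm_num)

/-- Since `u = ℓ` on the segment and the transversal directions are halved, convexity places the
rescaled function below the mean of `u` and `ℓ`. -/
theorem ConvexOn.rescaled_le (hu : ConvexOn ℝ Ω u) (he : ‖e‖ = 1) (hβ : 0 ≤ β) {r ρ : ℝ}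
    (hr : β * r ≤ ρ) (hrΩ : ball x₀ r ⊆ Ω)
    (hseg : ∀ t : ℝ, |t| ≤ ρ → x₀ + t • e ∈ contactSet Ω u p x₀) (hx : x ∈ ball x₀ r) :
    rescaled u p x₀ e β x ≤ (u x + (u x₀ + inner ℝ p (x - x₀))) / 2 := by
  obtain ⟨hyΩ, hy⟩ := hseg _ (abs_mul_inner_le he hβ hr hx)
  have h1 := hu.2 (hrΩ hx) hyΩ (show (0 : ℝ) ≤ 1 / 2 by norm_num)
    (show (0 : ℝ) ≤ 1 / 2 by norm_num) (by norm_num)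
  rw [← add_stretch_eq, hy, add_sub_cancel_left, smul_eq_mul, smul_eq_mul] at h1
  have h2 : inner ℝ p (x - x₀ - stretch e β (x - x₀)) =
      (1 / 2) * inner ℝ p (x - x₀) - (1 / 2) * inner ℝ p ((β * inner ℝ e (x - x₀)) • e) := by
    rw [stretch_apply, inner_sub_right, inner_smul_right _ _ (1 / 2 : ℝ), inner_add_right]
    ring
  rw [rescaled, h2]
  linarith

theorem ConvexOn.convexOn_rescaled (hu : ConvexOn ℝ Ω u) {r : ℝ}
    (hmem : ∀ x ∈ ball x₀ r, x₀ + stretch e β (x - x₀) ∈ Ω) :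
    ConvexOn ℝ (ball x₀ r) (rescaled u p x₀ e β) := by
  refine ⟨convex_ball x₀ r, fun x hx y hy a b ha hb hab => ?_⟩
  have h1 := hu.2 (hmem x hx) (hmem y hy) ha hb hab
  have hx₀ : x₀ = a • x₀ + b • x₀ := by rw [← add_smul, hab, one_smul]
  have h2 : a • x + b • y - x₀ = a • (x - x₀) + b • (y - x₀) := by
    nth_rewrite 1 [hx₀]
    module
  have h3 : x₀ + stretch e β (a • x + b • y - x₀) =
      a • (x₀ + stretch e β (x - x₀)) + b • (x₀ + stretch e β (y - x₀)) := by
    rw [h2, map_add, map_smul, map_smul]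
    nth_rewrite 1 [hx₀]
    module
  have h4 : a • x + b • y - x₀ - stretch e β (a • x + b • y - x₀) =
      a • (x - x₀ - stretch e β (x - x₀)) + b • (y - x₀ - stretch e β (y - x₀)) := by
    rw [h2, map_add, map_smul, map_smul]
    module
  rw [rescaled, h3, h4, inner_add_right, inner_smul_right, inner_smul_right, rescaled, rescaled]
  simp only [smul_eq_mul] at h1 ⊢
  linarith

/-- The Monge-Ampère measure picks up the square of the determinant of the stretching map. -/
theorem MongeAmpereBounds.le_mongeAmpere_rescaled (hMA : MongeAmpereBounds Ω u lam Lam)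
    (hdet : 0 < LinearMap.det (stretch e β)) {r : ℝ}
    (hmem : ∀ x ∈ ball x₀ r, x₀ + stretch e β (x - x₀) ∈ Ω)
    {A : Set (EuclideanSpace ℝ (Fin n))} (hA : MeasurableSet A) (hAr : A ⊆ ball x₀ r) :
    ENNReal.ofReal (LinearMap.det (stretch e β)) * (ENNReal.ofReal lam *
      (ENNReal.ofReal (LinearMap.det (stretch e β)) * volume A)) ≤
      mongeAmpere (ball x₀ r) (rescaled u p x₀ e β) A := by
  set T : EuclideanSpace ℝ (Fin n) → EuclideanSpace ℝ (Fin n) := fun x =>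
    x₀ + stretch e β (x - x₀) with hT
  have hTA : T '' A = (x₀ - stretch e β x₀) +ᵥ stretch e β '' A := by
    ext y
    simp only [hT, mem_image, mem_vadd_set, vadd_eq_add, exists_exists_and_eq_and, map_sub]
    refine exists_congr fun x => and_congr_right fun _ => ?_
    rw [show x₀ + (stretch e β x - stretch e β x₀) = x₀ - stretch e β x₀ + stretch e β x by abel]
  have hAm : MeasurableSet (stretch e β '' A) :=
    hA.image_of_continuousOn_injOn (LinearMap.continuous_of_finiteDimensional _).continuousOn
      ((LinearMap.equivOfDetNeZero _ hdet.ne').injective.injOn)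
  have hsub : (p - stretch e β p) +ᵥ stretch e β '' (⋃ y ∈ T '' A, subgradient Ω u y) ⊆
      ⋃ x ∈ A, subgradient (ball x₀ r) (rescaled u p x₀ e β) x := by
    rintro _ ⟨_, ⟨q, hq, rfl⟩, rfl⟩
    obtain ⟨_, ⟨x, hx, rfl⟩, hq⟩ := mem_iUnion₂.1 hq
    refine mem_iUnion₂.2 ⟨x, hx, fun y hy => ?_⟩
    have h1 := hq _ (hmem y hy)
    have h2 : x₀ + stretch e β (y - x₀) - T x = stretch e β (y - x) := by
      simp only [hT, map_sub]
      abel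
    have h3 : y - x₀ - stretch e β (y - x₀) =
        (x - x₀ - stretch e β (x - x₀)) + ((y - x) - stretch e β (y - x)) := by
      simp only [map_sub]
      abel
    rw [h2, inner_stretch_right] at h1
    rw [rescaled, rescaled, h3]
    change u (T x) + _ + inner ℝ (p - stretch e β p + stretch e β q) (y - x) ≤ _
    simp only [inner_add_left, inner_sub_left, inner_add_right (y := x - x₀ - stretch e β (x - x₀)),
      inner_sub_right p (y - x), inner_stretch_right p (y - x)]
    linarith
  have h := (hMA (T '' A) (hTA ▸ hAm.const_vadd _)
    (image_subset_iff.2 fun x hx => hmem x (hAr hx))).1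
  rw [hTA, measure_vadd, Measure.addHaar_image_linearMap, abs_of_pos hdet, ← hTA] at h
  calc _ ≤ ENNReal.ofReal (LinearMap.det (stretch e β)) * mongeAmpere Ω u (T '' A) :=
        mul_le_mul_right h _
    _ = volume ((p - stretch e β p) +ᵥ stretch e β '' (⋃ y ∈ T '' A, subgradient Ω u y)) := by
        rw [measure_vadd, Measure.addHaar_image_linearMap, abs_of_pos hdet, mongeAmpere]
    _ ≤ _ := measure_mono hsub

/-- A function with Monge-Ampère measure bounded below is not affine on any ball. -/
theorem MongeAmpereBounds.exists_lt (hMA : MongeAmpereBounds Ω u lam Lam)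
    (hlam : 0 < lam) (hn : n ≠ 0) (hp : p ∈ subgradient Ω u x₀) {r : ℝ} (hr : 0 < r)
    (hrΩ : ball x₀ r ⊆ Ω) :
    ∃ y ∈ ball x₀ r, u x₀ + inner ℝ p (y - x₀) < u y := by
  by_contra! h
  have heq : ∀ y ∈ ball x₀ r, u y = u x₀ + inner ℝ p (y - x₀) := fun y hy =>
    le_antisymm (h y hy) (hp y (hrΩ hy))
  have hsub : ⋃ x ∈ ball x₀ r, subgradient Ω u x ⊆ {p} := by
    refine iUnion₂_subset fun x hx q hq => ?_
    have hconst : LipschitzOnWith 0 (fun _ : EuclideanSpace ℝ (Fin n) => (0 : ℝ)) (ball x₀ r) :=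
      (LipschitzWith.const 0).lipschitzOnWith
    have hqp : q - p ∈ subgradient (ball x₀ r) (fun _ => (0 : ℝ)) x := fun y hy => by
      have h1 := hq y (hrΩ hy)
      rw [heq x hx, heq y hy] at h1
      simp only [inner_sub_left, inner_sub_right] at h1 ⊢
      linarith
    have := norm_le_of_mem_subgradient isOpen_ball hconst hx hqp
    exact sub_eq_zero.1 (norm_le_zero_iff.1 (by simpa using this))
  have : Nontrivial (EuclideanSpace ℝ (Fin n)) :=
    Module.nontrivial_of_finrank_pos (R := ℝ) (by
      rw [finrank_euclideanSpace_fin]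
      exact Nat.pos_of_ne_zero hn)
  have h1 := (hMA (ball x₀ r) measurableSet_ball hrΩ).1
  have h2 : mongeAmpere Ω u (ball x₀ r) = 0 := measure_mono_null hsub (measure_singleton p)
  rw [h2, nonpos_iff_eq_zero, mul_eq_zero, ENNReal.ofReal_eq_zero] at h1
  exact h1.elim (not_le.2 hlam) (measure_ball_pos volume x₀ hr).ne'

end Rescaling

/-! ### Touching from below at points without strict convexity -/

theorem theorem1p1 (n : ℕ) (Ω : Set (EuclideanSpace ℝ (Fin n))) (hΩ : IsOpen Ω)
    (u : EuclideanSpace ℝ (Fin n) → ℝ) (hu : ConvexOn ℝ Ω u)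
    (lam Lam : ℝ) (hlam : 0 < lam) (hMA : MongeAmpereBounds Ω u lam Lam)
    (a b : EuclideanSpace ℝ (Fin n)) (hab : a ≠ b)
    (hL : segment ℝ a b ⊆ nonStrictlyConvexSet Ω u)
    (x₀ : EuclideanSpace ℝ (Fin n)) (hx₀ : x₀ ∈ openSegment ℝ a b) :
    ∃ (U : Set (EuclideanSpace ℝ (Fin n))) (v : EuclideanSpace ℝ (Fin n) → ℝ),
      IsOpen U ∧ x₀ ∈ U ∧ U ⊆ Ω ∧ ConvexOn ℝ U v ∧
      (∃ x ∈ U, v x ≠ u x) ∧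
      TouchesFromBelowAt U v u x₀ ∧
      (∀ E : Set (EuclideanSpace ℝ (Fin n)), MeasurableSet E → E ⊆ U →
        mongeAmpere U v E = mongeAmpere Ω u E) := by
  obtain ⟨p, hp, e, he, ρ, hρ, hseg⟩ := hMA.exists_affine_segment hΩ hu hlam
    (hL (openSegment_subset_segment ℝ a b hx₀))
  have hx₀Ω : x₀ ∈ Ω := (hL (openSegment_subset_segment ℝ a b hx₀)).1
  have hn : n ≠ 0 := by
    rintro rfl
    exact hab (Subsingleton.elim a b)
  -- `β` is chosen so that the determinant `d` of the stretching map satisfies `lam * d ^ 2 ≥ Lam`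
  set d : ℝ := 2 + |Lam| / lam with hd
  set β : ℝ := 2 ^ n * d - 1 with hβdef
  have hd2 : 2 ≤ d := le_add_of_nonneg_right (by positivity)
  have hβ : 0 ≤ β := by
    have : (1 : ℝ) ≤ 2 ^ n := one_le_pow₀ (by norm_num)
    nlinarith
  have hdet : LinearMap.det (stretch e β) = d := by
    rw [det_stretch he, hβdef, add_sub_cancel, ← mul_assoc, ← mul_pow]
    norm_num
  have hdLam : Lam ≤ d * (lam * d) := by
    have h1 : lam * d = 2 * lam + |Lam| := by
      rw [hd, mul_add, mul_div_cancel₀ _ hlam.ne']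
      ring
    rw [h1]
    nlinarith [le_abs_self Lam, abs_nonneg Lam]
  obtain ⟨r₀, hr₀, hr₀Ω⟩ := Metric.isOpen_iff.1 hΩ x₀ hx₀Ω
  set r₁ := min r₀ (ρ / (β + 1)) with hr₁def
  have hr₁ : 0 < r₁ := by positivity
  have hr₁Ω : ball x₀ r₁ ⊆ Ω := (ball_subset_ball (min_le_left _ _)).trans hr₀Ω
  have hβr₁ : β * r₁ ≤ ρ := by
    have h1 : r₁ * (β + 1) ≤ ρ := (le_div_iff₀ (by positivity)).1 (min_le_right _ _)
    linarith
  have hmem : ∀ x ∈ ball x₀ r₁, x₀ + stretch e β (x - x₀) ∈ Ω := fun x hx =>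
    hu.add_stretch_mem he hβ hβr₁ hr₁Ω hseg hx
  set w := rescaled u p x₀ e β with hwdef
  have hw : ConvexOn ℝ (ball x₀ r₁) w := hu.convexOn_rescaled hmem
  have hwle : ∀ x ∈ ball x₀ r₁, w x ≤ (u x + (u x₀ + inner ℝ p (x - x₀))) / 2 := fun x hx =>
    hu.rescaled_le he hβ hβr₁ hr₁Ω hseg hx
  have hwu : ∀ x ∈ ball x₀ r₁, w x ≤ u x := fun x hx => by
    have h1 := hwle x hx
    have h2 := hp x (hr₁Ω hx)
    linarith
  obtain ⟨Lu, su, hsu, hLu⟩ := hu.locallyLipschitzOn hΩ hx₀Ω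
  obtain ⟨Lw, sw, hsw, hLw⟩ := hw.locallyLipschitzOn isOpen_ball (mem_ball_self hr₁)
  rw [hΩ.nhdsWithin_eq hx₀Ω] at hsu
  rw [isOpen_ball.nhdsWithin_eq (mem_ball_self hr₁)] at hsw
  obtain ⟨r₂, hr₂, hr₂s⟩ := Metric.mem_nhds_iff.1
    (inter_mem (inter_mem hsu hsw) (ball_mem_nhds x₀ hr₁))
  obtain ⟨y, hy, hyu⟩ := hMA.exists_lt hlam hn hp hr₂
    ((hr₂s.trans inter_subset_right).trans hr₁Ω)
  have hR : 0 < dist y x₀ := dist_pos.2 fun h => by simp [h] at hyu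
  set R := dist y x₀ with hRdef
  have hRr₂ : closedBall x₀ R ⊆ ball x₀ r₂ := closedBall_subset_ball (mem_ball.1 hy)
  have hr₂₁ : ball x₀ r₂ ⊆ ball x₀ r₁ := hr₂s.trans inter_subset_right
  have hRΩ : ball x₀ R ⊆ Ω :=
    ((ball_subset_closedBall.trans hRr₂).trans hr₂₁).trans hr₁Ω
  have huL : LipschitzOnWith (max Lu Lw) u (ball x₀ r₂) :=
    (hLu.mono ((hr₂s.trans inter_subset_left).trans inter_subset_left)).weaken (le_max_left _ _)
  have hwL : LipschitzOnWith (max Lu Lw) w (ball x₀ r₂) :=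
    (hLw.mono ((hr₂s.trans inter_subset_left).trans inter_subset_right)).weaken (le_max_right _ _)
  have hwr₂ : ConvexOn ℝ (ball x₀ r₂) w := hw.subset hr₂₁ (convex_ball _ _)
  obtain ⟨v, hvc, hvconv, hv, hvw, hvMA⟩ := exists_mongeAmpere_eq_between hR (huL.mono hRr₂)
    (hwL.mono hRr₂) (fun x hx => by
      obtain ⟨q, hq⟩ := hwr₂.subgradient_nonempty isOpen_ball (hRr₂ hx)
      exact ⟨q, mem_closedBall_zero_iff.2
        (norm_le_of_mem_subgradient isOpen_ball hwL (hRr₂ hx) hq), fun z hz => hq z (hRr₂ hz)⟩)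
    (fun x hx => hwu x (hr₂₁ (hRr₂ hx))) fun A hA hAR => by
      rw [hu.mongeAmpere_eq_of_isOpen isOpen_ball hRΩ hAR,
        hw.mongeAmpere_eq_of_isOpen isOpen_ball
          ((ball_subset_closedBall.trans hRr₂).trans hr₂₁) hAR]
      refine (hMA A hA (hAR.trans hRΩ)).2.trans (le_trans ?_ (hMA.le_mongeAmpere_rescaled
        (by rw [hdet]; linarith) hmem hA
        (hAR.trans ((ball_subset_closedBall.trans hRr₂).trans hr₂₁))))
      rw [hdet, ← mul_assoc (ENNReal.ofReal lam), ← mul_assoc, ← ENNReal.ofReal_mul hlam.le,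
        ← ENNReal.ofReal_mul (by linarith)]
      exact mul_le_mul_left (ENNReal.ofReal_le_ofReal hdLam) _
  have hx₀R : x₀ ∈ ball x₀ R := mem_ball_self hR
  refine ⟨ball x₀ R, v, isOpen_ball, hx₀R, hRΩ, hvconv.subset (subset_univ _) (convex_ball _ _),
    ?_, ⟨fun x hx => (hv x (ball_subset_closedBall hx)).2, ?_⟩, fun A hA hAR => ?_⟩
  · -- otherwise `u = v = w` at the boundary point `y`, by continuity
    by_contra! h
    have hyR : y ∈ closedBall x₀ R := mem_closedBall.2 le_rfl
    have heq : EqOn v u (closedBall x₀ R) := by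
      have hcl : closure (ball x₀ R) = closedBall x₀ R := closure_ball x₀ hR.ne'
      exact EqOn.of_subset_closure h hvc.continuousOn (huL.continuousOn.mono hRr₂)
        ball_subset_closedBall hcl.ge
    have h1 := hvw y rfl
    have h2 := hwle y (hr₂₁ hy)
    have h3 := heq hyR
    linarith
  · have h1 := (hv x₀ (ball_subset_closedBall hx₀R))
    have h2 : w x₀ = u x₀ := rescaled_self
    exact le_antisymm h1.2 (h2 ▸ h1.1)
  · rw [hvMA A hA hAR, hu.mongeAmpere_eq_of_isOpen isOpen_ball hRΩ hAR]
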